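/- All Hilbert spaces are finite dimensional and nonzero. For a given pair of input and output systems a resource theory consists of a set $\mathbb{O}_{\rm all}$ of allowed quantum channels and a convex, closed set $\mathbb{O}\subseteq\mathbb{O}_{\rm all}$ of free channels. For channels $\mathcal{E},\mathcal{F}$ let $F(\mathcal{E},\mathcal{F})=\min_\rho F(\mathrm{id}\otimes\mathcal{E}(\rho),\mathrm{id}\otimes\mathcal{F}(\rho))$ be the worst-case fidelity, where $F(\rho,\sigma)=\|\sqrt\rho\sqrt\sigma\|_1^2$. All measures below take values in $[0,\infty]$, with $1/0=\infty$, $1/\infty=0$, $\inf\emptyset=\infty$; $\psi$ ranges over the pure states of the input system together with a reference copy of it, and $\Pi_\rho$ is the projection onto the support of $\rho$. Define $$R_{\min,\mathbb{O}}(\mathcal{E})=\min_{\mathcal{M}\in\mathbb{O}}\max_{\psi}\ \max\left\{\mathrm{Tr}\left(P\,\mathrm{id}\otimes\mathcal{M}(\psi)\right)^{-1} : 0\le P\le\mathbb{1},\ \mathrm{Tr}\left(P\,\mathrm{id}\otimes\mathcal{E}(\psi)\right)\ge 1\right\},$$ $$R_{\min,\mathrm{aff}(\mathbb{O})}(\mathcal{E})^{-1}=\inf_\psi\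 \sup_{\mathcal{M}\in\mathrm{aff}(\mathbb{O})}\mathrm{Tr}\left(\Pi_{\mathrm{id}\otimes\mathcal{E}(\psi)}\,\mathrm{id}\otimes\mathcal{M}(\psi)\right),$$ where $\mathrm{aff}(\mathbb{O})$ is the affine hull of $\mathbb{O}$ (if $\mathbb{O}=\emptyset$, the supremum is read as $0$); $$R_{\mathbb{O};\tilde{\mathbb{O}}}(\mathcal{E})=\inf\left\{1+r : r\ge 0,\ \mathcal{M}\in\tilde{\mathbb{O}},\ \tfrac{\mathcal{E}+r\mathcal{M}}{1+r}\in\mathbb{O}\right\},\qquad R_{s,\mathbb{O}}=R_{\mathbb{O};\mathbb{O}},\qquad R_{\max,\mathbb{O}}=R_{\mathbb{O};\mathbb{O}_{\rm all}};$$ and, for $0\le\epsilon\le1$ and $x\in\{s,\max\}$, $R_{x,\mathbb{O}}^\epsilon(\mathcal{E})=\inf\{R_{x,\mathbb{O}}(\mathcal{E}') : \mathcal{E}'\in\mathbb{O}_{\rm all},\ F(\mathcal{E}',\mathcal{E})\ge1-\epsilon\}$. Let $\mathbb{O}\subseteq\mathbb{O}_{\rm all}$ be a resource theory for one fixed pair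 of systems such that $\mathbb{O}_{\rm all}$ is also convex and closed, and let $\mathcal{E}\in\mathbb{O}_{\rm all}$ and $0\le\epsilon\le1$. Let $\mathbb{T}$ be any set of reference (target) channels, possibly acting on different systems; each $\mathcal{T}\in\mathbb{T}$ is an allowed channel, $\mathcal{T}\in\mathbb{O}'_{\rm all}$, of a resource theory $\mathbb{O}'\subseteq\mathbb{O}'_{\rm all}$ for its own pair of systems. A superchannel is a map $\Theta(\mathcal{L})=\mathcal{E}_{\rm post}\circ(\mathrm{id}\otimes\mathcal{L})\circ\mathcal{E}_{\rm pre}$ with $\mathcal{E}_{\rm pre},\mathcal{E}_{\rm post}$ channels and $\mathrm{id}$ the identity of a finite-dimensional memory system; it is free (from $\mathbb{O}'$ to $\mathbb{O}$) if $\Theta(\mathbb{O}'_{\rm all})\subseteq\mathbb{O}_{\rm all}$ and $\Theta(\mathbb{O}')\subseteq\mathbb{O}$. Let $$c^\epsilon(\mathcal{E})=\inf\left\{R_{\min,\mathbb{O}'}(\mathcal{T}) : \mathcal{T}\in\mathbb{T},\ \Theta\text{ a free superchannel},\ F(\mathcal{E},\Theta(\mathcal{T}))\ge1-\epsilon\right\},$$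 $$\lceil x\rceil_{\mathbb{T}}=\inf\left\{R_{\min,\mathbb{O}'}(\mathcal{T}) : \mathcal{T}\in\mathbb{T},\ R_{\min,\mathbb{O}'}(\mathcal{T})\ge x\right\}.$$ (i) If $R_{\min,\mathbb{O}'}(\mathcal{T})=R_{s,\mathbb{O}'}(\mathcal{T})$ for all $\mathcal{T}\in\mathbb{T}$, then $c^\epsilon(\mathcal{E})=\lceil R_{s,\mathbb{O}}^\epsilon(\mathcal{E})\rceil_{\mathbb{T}}$. (ii) If $R_{\min,\mathrm{aff}(\mathbb{O}')}(\mathcal{T})=R_{\max,\mathbb{O}'}(\mathcal{T})$ for all $\mathcal{T}\in\mathbb{T}$, then $c^\epsilon(\mathcal{E})=\lceil R_{\max,\mathbb{O}}^\epsilon(\mathcal{E})\rceil_{\mathbb{T}}$. -/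

import Mathlib

open scoped ENNReal NNReal ComplexOrder

noncomputable section

/-- Linear maps from operators on `ℂ^A` to operators on `ℂ^B`; the finite types `A`, `B` index
orthonormal bases of the input and output Hilbert spaces. -/
abbrev SuperOp (A B : Type*) : Type _ := Matrix A A ℂ →ₗ[ℂ] Matrix B B ℂ

/-- The map `id_R ⊗ Φ`. -/
def idTensor (R : Type*) {A B : Type*} (Φ : SuperOp A B) : SuperOp (R × A) (R × B) where
  toFun X := Matrix.of fun p q => Φ (Matrix.of fun a a' => X (p.1, a) (q.1, a')) p.2 q.2
  map_add' X Y := by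
    ext p q
    exact congrFun (congrFun (Φ.map_add (Matrix.of fun a a' => X (p.1, a) (q.1, a'))
      (Matrix.of fun a a' => Y (p.1, a) (q.1, a'))) p.2) q.2
  map_smul' c X := by
    ext p q
    exact congrFun (congrFun (Φ.map_smul c (Matrix.of fun a a' => X (p.1, a) (q.1, a'))) p.2) q.2

/-- Complete positivity: `id ⊗ Φ` preserves positive semidefiniteness for every finite-dimensional
reference system. -/
def IsCompletelyPositive {A B : Type*} (Φ : SuperOp A B) : Prop :=
  ∀ (n : ℕ) (X : Matrix (Fin n × A) (Fin n × A) ℂ),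
    X.PosSemidef → (idTensor (Fin n) Φ X).PosSemidef

/-- Quantum channels: completely positive trace-preserving maps. -/
def IsChannel {A B : Type*} [Fintype A] [Fintype B] (Φ : SuperOp A B) : Prop :=
  IsCompletelyPositive Φ ∧ ∀ X : Matrix A A ℂ, (Φ X).trace = X.trace

/-- The Choi matrix `∑ |a⟩⟨a'| ⊗ Φ(|a⟩⟨a'|)`. -/
def choi {A B : Type*} [DecidableEq A] (Φ : SuperOp A B) : Matrix (A × B) (A × B) ℂ :=
  Matrix.of fun p q => Φ (Matrix.single p.1 q.1 1) p.2 q.2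

/-- Closedness of a set of maps in the (unique) finite-dimensional vector space topology, expressed
through the linear isomorphism given by the Choi matrix. -/
def IsClosedOps {A B : Type*} [DecidableEq A] (S : Set (SuperOp A B)) : Prop :=
  IsClosed (choi '' S)

/-- The data of a resource theory for one fixed pair of input and output systems: the set `all` of
allowed channels and the set `free` of free channels, which is convex and closed. -/
structure ResourceTheory (A B : Type*) [Fintype A] [DecidableEq A] [Fintype B] where
  /-- the allowed channels -/
  all : Set (SuperOp A B)
  /-- the free channels -/
  free : Set (SuperOp A B)
  isChannel_of_mem_all : ∀ Φ ∈ all, IsChannel Φ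
  free_subset_all : free ⊆ all
  convex_free : Convex ℝ free
  isClosed_free : IsClosedOps free

/-- Density matrices on `ℂ^X`. -/
def DensityMatrix (X : Type*) [Fintype X] : Type _ :=
  {ρ : Matrix X X ℂ // ρ.PosSemidef ∧ ρ.trace = 1}

/-- The fidelity `‖√ρ √σ‖₁²`, with `‖Y‖₁ = Tr √(Yᴴ Y)`. -/
def fidelity {X : Type*} [Fintype X] [DecidableEq X] (ρ σ : Matrix X X ℂ) : ℝ :=
  (cfc Real.sqrt ((cfc Real.sqrt ρ * cfc Real.sqrt σ).conjTranspose *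
    (cfc Real.sqrt ρ * cfc Real.sqrt σ))).trace.re ^ 2

/-- The worst-case fidelity of two channels, over all states of the input system and a reference
system isomorphic to it. -/
def channelFidelity {A B : Type*} [Fintype A] [Fintype B] [DecidableEq B] [DecidableEq A]
    (Φ Ψ : SuperOp A B) : ℝ :=
  ⨅ ρ : DensityMatrix (A × A), fidelity (idTensor A Φ ρ.1) (idTensor A Ψ ρ.1)

/-- Unit vectors of `ℂ^A ⊗ ℂ^A` (reference and input system). -/
def PureVec (A : Type*) [Fintype A] : Type _ :=
  {v : EuclideanSpace ℂ (A × A) // ‖v‖ = 1}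

/-- The rank-one projection `|v⟩⟨v|`. -/
def PureVec.proj {A : Type*} [Fintype A] (v : PureVec A) : Matrix (A × A) (A × A) ℂ :=
  Matrix.vecMulVec (fun x => v.1 x) (fun x => star (v.1 x))

/-- The hypothesis testing quantity `R_H^ε(ρ‖σ) = max {Tr(Pσ)⁻¹ | 0 ≤ P ≤ 1, Tr(Pρ) ≥ 1 - ε}` of
positive semidefinite matrices, with `0⁻¹ = ∞`. -/
def hypTest {X : Type*} [Fintype X] [DecidableEq X] (ε : ℝ) (ρ σ : Matrix X X ℂ) : ℝ≥0∞ :=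
  ⨆ (P : Matrix X X ℂ) (_ : P.PosSemidef) (_ : (1 - P).PosSemidef)
    (_ : 1 - ε ≤ (P * ρ).trace.re), (ENNReal.ofReal (P * σ).trace.re)⁻¹

/-- `R_{H,𝕆}^ε(Φ)`, the hypothesis testing measure with respect to a set `O` of channels. -/
def RH {A B : Type*} [Fintype A] [Fintype B] [DecidableEq A] [DecidableEq B] (ε : ℝ)
    (O : Set (SuperOp A B)) (Φ : SuperOp A B) : ℝ≥0∞ :=
  ⨅ M ∈ O, ⨆ v : PureVec A, hypTest ε (idTensor A Φ v.proj) (idTensor A M v.proj)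

/-- `R_{min,𝕆}(Φ)`. -/
def Rmin {A B : Type*} [Fintype A] [Fintype B] [DecidableEq A] [DecidableEq B]
    (O : Set (SuperOp A B)) (Φ : SuperOp A B) : ℝ≥0∞ :=
  RH 0 O Φ

/-- The orthogonal projection onto the support of a Hermitian matrix (the spectral projection for
the nonzero eigenvalues). -/
def supportProj {X : Type*} [Fintype X] [DecidableEq X] (ρ : Matrix X X ℂ) : Matrix X X ℂ :=
  cfc (fun x : ℝ => if x = 0 then (0 : ℝ) else 1) ρ

/-- `R_{min,aff(𝕆)}(Φ)`, given by
`R_{min,aff(𝕆)}(Φ)⁻¹ = inf_ψ sup_{M ∈ aff(𝕆)} Tr(Π_{id ⊗ Φ(ψ)} (id ⊗ M)(ψ))`.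
For nonempty `𝕆` the supremum is `∞` unless the trace has the same value `λ ≥ 0` for all `M ∈ 𝕆`; then it is
`λ`; in particular clipping negative traces by `ENNReal.ofReal` does not affect it. -/
def RminAff {A B : Type*} [Fintype A] [Fintype B] [DecidableEq A] [DecidableEq B]
    (O : Set (SuperOp A B)) (Φ : SuperOp A B) : ℝ≥0∞ :=
  (⨅ v : PureVec A, ⨆ M ∈ affineSpan ℝ O,
    ENNReal.ofReal (supportProj (idTensor A Φ v.proj) * idTensor A M v.proj).trace.re)⁻¹

/-- The robustness `R_{𝕆;𝕆̃}(Φ) = inf {1 + r | r ≥ 0, (Φ + r M)/(1 + r) ∈ 𝕆, M ∈ 𝕆̃}`. -/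
def robustness {A B : Type*} (O O' : Set (SuperOp A B)) (Φ : SuperOp A B) : ℝ≥0∞ :=
  ⨅ (r : ℝ≥0) (M ∈ O') (_ : (1 + (r : ℝ))⁻¹ • (Φ + (r : ℝ) • M) ∈ O), 1 + (r : ℝ≥0∞)

/-- The standard robustness `R_{s,𝕆}`. -/
def Rs {A B : Type*} [Fintype A] [DecidableEq A] [Fintype B]
    (𝓡 : ResourceTheory A B) (Φ : SuperOp A B) : ℝ≥0∞ :=
  robustness 𝓡.free 𝓡.free Φ

/-- The generalized robustness `R_{max,𝕆}`. -/
def Rmax {A B : Type*} [Fintype A] [DecidableEq A] [Fintype B]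
    (𝓡 : ResourceTheory A B) (Φ : SuperOp A B) : ℝ≥0∞ :=
  robustness 𝓡.free 𝓡.all Φ

/-- The smoothed version of a measure `f`: its infimum over the allowed channels whose fidelity with
`Φ` is at least `1 - ε`. -/
def smooth {A B : Type*} [Fintype A] [DecidableEq A] [Fintype B] [DecidableEq B]
    (𝓡 : ResourceTheory A B) (f : SuperOp A B → ℝ≥0∞) (ε : ℝ) (Φ : SuperOp A B) : ℝ≥0∞ :=
  ⨅ Φ' ∈ 𝓡.all, ⨅ (_ : 1 - ε ≤ channelFidelity Φ' Φ), f Φ'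

/-- Quantum superchannels, transforming channels `A → B` to channels `C → D`: maps of the form
`L ↦ post ∘ (id_R ⊗ L) ∘ pre`, where `R` is a finite-dimensional memory and `pre : C → R ⊗ A`,
`post : R ⊗ B → D` are channels. -/
def IsSuperchannel {A B C D : Type*} [Fintype A] [Fintype B] [Fintype C] [Fintype D]
    (Θ : SuperOp A B → SuperOp C D) : Prop :=
  ∃ (n : ℕ) (pre : SuperOp C (Fin n × A)) (post : SuperOp (Fin n × B) D),
    IsChannel pre ∧ IsChannel post ∧ ∀ L, Θ L = post ∘ₗ idTensor (Fin n) L ∘ₗ pre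

/-- The free superchannels between two theories: superchannels that map allowed channels to allowed
channels and free channels to free channels. -/
def freeSuperchannels {A B C D : Type*} [Fintype A] [DecidableEq A] [Fintype B]
    [Fintype C] [DecidableEq C] [Fintype D]
    (𝓡 : ResourceTheory A B) (𝓢 : ResourceTheory C D) : Set (SuperOp A B → SuperOp C D) :=
  {Θ | IsSuperchannel Θ ∧ (∀ L ∈ 𝓡.all, Θ L ∈ 𝓢.all) ∧ ∀ M ∈ 𝓡.free, Θ M ∈ 𝓢.free}

/-- The one-shot resource cost of `Φ` with respect to a set `𝓣` of reference channels, which may act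
on different systems, indexed by `ι`, each with its own sets of allowed and free channels:
`inf {R_min(T) | F(Φ, Θ(T)) ≥ 1 - ε, T ∈ 𝓣, Θ free}`. -/
def resourceCost {ι : Type*} {A B : ι → Type*} [∀ i, Fintype (A i)] [∀ i, DecidableEq (A i)]
    [∀ i, Fintype (B i)] [∀ i, DecidableEq (B i)] {C D : Type*} [Fintype C] [DecidableEq C]
    [Fintype D] [DecidableEq D] (𝓡' : ∀ i, ResourceTheory (A i) (B i))
    (𝓡 : ResourceTheory C D) (𝓣 : Set (Σ i, SuperOp (A i) (B i))) (ε : ℝ)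
    (Φ : SuperOp C D) : ℝ≥0∞ :=
  ⨅ T ∈ 𝓣, ⨅ Θ ∈ freeSuperchannels (𝓡' T.1) 𝓡, ⨅ (_ : 1 - ε ≤ channelFidelity Φ (Θ T.2)),
    Rmin (𝓡' T.1).free T.2

/-- `⌈x⌉_𝓣 = inf {R_min(T) | T ∈ 𝓣, R_min(T) ≥ x}`. -/
def ceilRef {ι : Type*} {A B : ι → Type*} [∀ i, Fintype (A i)] [∀ i, DecidableEq (A i)]
    [∀ i, Fintype (B i)] [∀ i, DecidableEq (B i)] (𝓡' : ∀ i, ResourceTheory (A i) (B i))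
    (𝓣 : Set (Σ i, SuperOp (A i) (B i))) (x : ℝ≥0∞) : ℝ≥0∞ :=
  ⨅ T ∈ 𝓣, ⨅ (_ : x ≤ Rmin (𝓡' T.1).free T.2), Rmin (𝓡' T.1).free T.2

end

noncomputable section

open Filter Topology

/-! ### Fidelity -/

section Fidelity

variable {X : Type*} [Fintype X] [DecidableEq X]

/-! Write `R` for the robustness in question (`Rs` or `Rmax`). Both parts combine monotonicity of
`R` with a measure-and-prepare construction.

Cost is at least the rounded measure: a superchannel is linear, so a free one carries a
decomposition witnessing `R(T)` to one for `Θ T` with the same `r` (`robustness_map_le`). If `Θ T`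
is close to `Φ`, it competes in the smoothing, whence `R^ε(Φ) ≤ R(Θ T) ≤ R(T) = R_min(T)`, and `T`
is admissible in the ceiling.

Conversely let `k = R_min(T) ≥ R^ε(Φ)` be finite. Compactness gives an allowed `Ψ` close to `Φ` and
a channel `N`, free in (i) and allowed in (ii), such that `k⁻¹ Ψ + (1 - k⁻¹) N` is free
(`exists_mix_of_smooth_le`). Feed a pure state into the given channel, apply to the output a test
that `T` passes with certainty, and prepare `Ψ` on acceptance, `N` on rejection. Then `T` becomes
`Ψ`, while a free `M` becomes `t Ψ + (1 - t) N`, where `t` is its acceptance probability.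

In (i) it suffices that `t ≤ k⁻¹`, since the surplus weight falls on the free channel `N`. The
definition of `R_min` supplies such a test for each `M` separately; a minimax argument yields one
random mixture of tests good for all `M` (`exists_tests_of_le_Rmin`).

In (ii) `N` need not be free, so `t` must equal `k⁻¹` exactly. This is what the affine hull
provides: an affine function bounded above on an affine space is constant
(`exists_perfectTest_of_RminAff`). The chain `RminAff ≤ Rmin ≤ Rmax` collapses by hypothesis. -/

theorem Matrix.IsHermitian.trace_cfc {M : Matrix X X ℂ} (hM : M.IsHermitian) (f : ℝ → ℝ) :
    (cfc f M).trace = ∑ i, (f (hM.eigenvalues i) : ℂ) := by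
  rw [hM.cfc_eq, Matrix.IsHermitian.cfc, Unitary.conjStarAlgAut_apply, Matrix.trace_mul_cycle]
  simp [Matrix.trace]

/-- The two products have the same characteristic polynomial, hence the same eigenvalues with
multiplicity. This makes the fidelity symmetric. -/
theorem Matrix.trace_cfc_conjTranspose_mul_self_comm (M : Matrix X X ℂ) (f : ℝ → ℝ) :
    (cfc f (M.conjTranspose * M)).trace = (cfc f (M * M.conjTranspose)).trace := by
  have h₁ := Matrix.isHermitian_conjTranspose_mul_self M
  have h₂ := Matrix.isHermitian_mul_conjTranspose_self M
  have h : h₁.eigenvalues = h₂.eigenvalues :=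
    (h₁.eigenvalues_eq_eigenvalues_iff h₂).2 (Matrix.charpoly_mul_comm _ _)
  rw [h₁.trace_cfc, h₂.trace_cfc, h]

theorem conjTranspose_cfc (f : ℝ → ℝ) (M : Matrix X X ℂ) :
    (cfc f M).conjTranspose = cfc f M :=
  (cfc_predicate f M : IsSelfAdjoint (cfc f M))

theorem fidelity_comm (ρ σ : Matrix X X ℂ) : fidelity ρ σ = fidelity σ ρ := by
  unfold fidelity
  rw [Matrix.trace_cfc_conjTranspose_mul_self_comm]
  simp only [Matrix.conjTranspose_mul, conjTranspose_cfc]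

open scoped Matrix.Norms.L2Operator in
theorem Matrix.continuousOn_cfc_isHermitian {f : ℝ → ℝ} (hf : Continuous f) :
    ContinuousOn (fun M : Matrix X X ℂ => cfc f M) {M | M.IsHermitian} := by
  have := ContinuousOn.cfc_of_mem_nhdsSet (𝕜 := ℝ) (A := Matrix X X ℂ) (s := Set.univ)
    (p := IsSelfAdjoint) f (a := id) (t := {M : Matrix X X ℂ | M.IsHermitian}) Filter.univ_mem
    continuousOn_id (fun x hx => hx) hf.continuousOn
  exact this

theorem continuousOn_fidelity_left (σ : Matrix X X ℂ) :
    ContinuousOn (fun ρ => fidelity ρ σ) {ρ : Matrix X X ℂ | ρ.IsHermitian} := by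
  unfold fidelity
  have h := Matrix.continuousOn_cfc_isHermitian (X := X) Real.continuous_sqrt
  have h₁ : ContinuousOn (fun ρ : Matrix X X ℂ => cfc Real.sqrt ρ * cfc Real.sqrt σ)
      {ρ | ρ.IsHermitian} := h.mul continuousOn_const
  have h₂ : ContinuousOn (fun ρ : Matrix X X ℂ => (cfc Real.sqrt ρ * cfc Real.sqrt σ).conjTranspose *
      (cfc Real.sqrt ρ * cfc Real.sqrt σ)) {ρ | ρ.IsHermitian} :=
    (continuous_id.matrix_conjTranspose.comp_continuousOn h₁).mul h₁
  have h₃ := h.comp h₂ fun ρ _ => Matrix.isHermitian_conjTranspose_mul_self _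
  exact ((Complex.continuous_re.comp continuous_id.matrix_trace).comp_continuousOn h₃).pow 2

end Fidelity

section ChannelFidelity

variable {A B : Type*} [Fintype A] [DecidableEq A] [Fintype B] [DecidableEq B]

theorem channelFidelity_comm (Φ Ψ : SuperOp A B) : channelFidelity Φ Ψ = channelFidelity Ψ Φ := by
  unfold channelFidelity
  simp only [fidelity_comm]

instance DensityMatrix.instNonempty (X : Type*) [Fintype X] [DecidableEq X] [Nonempty X] :
    Nonempty (DensityMatrix X) := by
  obtain ⟨x⟩ := ‹Nonempty X›
  refine ⟨⟨Matrix.diagonal (Pi.single x 1), Matrix.PosSemidef.diagonal ?_, by simp⟩⟩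
  exact Pi.single_nonneg.2 zero_le_one

/-- Nonemptiness of `A` matters: a real infimum over an empty family would be `0`. -/
theorem le_channelFidelity_iff [Nonempty A] {c : ℝ} {Φ Ψ : SuperOp A B} :
    c ≤ channelFidelity Φ Ψ ↔
      ∀ ρ : DensityMatrix (A × A), c ≤ fidelity (idTensor A Φ ρ.1) (idTensor A Ψ ρ.1) := by
  refine ⟨fun h ρ => h.trans (ciInf_le ⟨0, ?_⟩ ρ), fun h => le_ciInf h⟩
  rintro _ ⟨ρ, rfl⟩
  exact sq_nonneg _

end ChannelFidelity

/-! ### Choi matrices -/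

/-- Needed to extract convergent subsequences from compact sets of matrices. -/
instance Matrix.instFirstCountableTopology {X Y R : Type*} [Countable X] [Countable Y]
    [TopologicalSpace R] [FirstCountableTopology R] : FirstCountableTopology (Matrix X Y R) :=
  inferInstanceAs (FirstCountableTopology (X → Y → R))

section Choi

variable {A B : Type*}

@[simp]
theorem idTensor_apply (R : Type*) (Φ : SuperOp A B) (X : Matrix (R × A) (R × A) ℂ) (p q : R × B) :
    idTensor R Φ X p q = Φ (Matrix.of fun a a' => X (p.1, a) (q.1, a')) p.2 q.2 := rfl

theorem idTensor_submatrix {R S : Type*} (e : S → R) (Φ : SuperOp A B)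
    (X : Matrix (R × A) (R × A) ℂ) :
    idTensor S Φ (X.submatrix (Prod.map e id) (Prod.map e id)) =
      (idTensor R Φ X).submatrix (Prod.map e id) (Prod.map e id) := rfl

theorem IsCompletelyPositive.posSemidef_idTensor {Φ : SuperOp A B} (hΦ : IsCompletelyPositive Φ)
    {R : Type*} [Finite R] {X : Matrix (R × A) (R × A) ℂ} (hX : X.PosSemidef) :
    (idTensor R Φ X).PosSemidef := by
  obtain ⟨n, ⟨e⟩⟩ := Finite.exists_equiv_fin R
  have h := hΦ n _ (hX.submatrix (Prod.map e.symm id))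
  rw [idTensor_submatrix] at h
  have h' := h.submatrix (Prod.map e id)
  rw [Matrix.submatrix_submatrix] at h'
  convert h' using 1
  ext p q
  simp

variable [Fintype A] [DecidableEq A]

theorem SuperOp.apply_eq_sum_choi (Φ : SuperOp A B) (X : Matrix A A ℂ) (b b' : B) :
    Φ X b b' = ∑ a, ∑ a', X a a' * choi Φ (a, b) (a', b') := by
  conv_lhs => rw [Matrix.matrix_eq_sum_single X]
  simp only [map_sum, Matrix.sum_apply]
  refine Finset.sum_congr rfl fun a _ => Finset.sum_congr rfl fun a' _ => ?_
  have : Matrix.single a a' (X a a') = X a a' • Matrix.single a a' (1 : ℂ) := by simp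
  rw [this, map_smul]
  rfl

theorem choi_injective : Function.Injective (choi : SuperOp A B → Matrix (A × B) (A × B) ℂ) := by
  intro Φ Ψ h
  refine LinearMap.ext fun X => ?_
  ext b b'
  rw [Φ.apply_eq_sum_choi, Ψ.apply_eq_sum_choi, h]

omit [Fintype A] in
theorem choi_add (Φ Ψ : SuperOp A B) : choi (Φ + Ψ) = choi Φ + choi Ψ := rfl

omit [Fintype A] in
theorem choi_smul (c : ℝ) (Φ : SuperOp A B) : choi (c • Φ) = c • choi Φ := rfl

omit [Fintype A] in
theorem convex_image_choi {S : Set (SuperOp A B)} (hS : Convex ℝ S) : Convex ℝ (choi '' S) := by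
  rintro _ ⟨Φ, hΦ, rfl⟩ _ ⟨Ψ, hΨ, rfl⟩ a b ha hb hab
  exact ⟨_, hS hΦ hΨ ha hb hab, by simp only [choi_add, choi_smul]⟩

theorem idTensor_apply_eq_sum_choi (R : Type*) (Φ : SuperOp A B) (X : Matrix (R × A) (R × A) ℂ)
    (p q : R × B) :
    idTensor R Φ X p q = ∑ a, ∑ a', X (p.1, a) (q.1, a') * choi Φ (a, p.2) (a', q.2) := by
  rw [idTensor_apply, SuperOp.apply_eq_sum_choi]
  rfl

omit [Fintype A] in
theorem tendsto_idTensor [Finite A] {ι R : Type*} {l : Filter ι} {Φ : ι → SuperOp A B}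
    {Ψ : SuperOp A B} (h : Tendsto (fun i => choi (Φ i)) l (𝓝 (choi Ψ)))
    (X : Matrix (R × A) (R × A) ℂ) :
    Tendsto (fun i => idTensor R (Φ i) X) l (𝓝 (idTensor R Ψ X)) := by
  have := Fintype.ofFinite A
  refine tendsto_pi_nhds.2 fun p => tendsto_pi_nhds.2 fun q => ?_
  simp only [idTensor_apply_eq_sum_choi]
  refine tendsto_finsetSum _ fun a _ => tendsto_finsetSum _ fun a' _ => ?_
  exact ((tendsto_pi_nhds.1 (tendsto_pi_nhds.1 h (a, p.2))) (a', q.2)).const_mul _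

omit [Fintype A] in
-- The input is the unnormalised maximally entangled state.
theorem choi_eq_idTensor (Φ : SuperOp A B) :
    choi Φ = idTensor A Φ (Matrix.vecMulVec (fun p => if p.1 = p.2 then 1 else 0)
      (star fun p => if p.1 = p.2 then (1 : ℂ) else 0)) := by
  ext p q
  refine congrArg (fun M => Φ M p.2 q.2) ?_
  ext a a'
  simp only [Matrix.single_apply, Matrix.of_apply, Matrix.vecMulVec_apply, Pi.star_apply]
  split_ifs <;> simp_all

theorem IsCompletelyPositive.posSemidef_choi {Φ : SuperOp A B} (hΦ : IsCompletelyPositive Φ) :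
    (choi Φ).PosSemidef := by
  rw [choi_eq_idTensor]
  exact hΦ.posSemidef_idTensor (Matrix.posSemidef_vecMulVec_self_star _)

omit [Fintype A] [DecidableEq A] in
open scoped MatrixOrder in
theorem Matrix.PosSemidef.exists_eq_conjTranspose_mul_self [Fintype A]
    {M : Matrix A A ℂ} (hM : M.PosSemidef) :
    ∃ Q : Matrix A A ℂ, M = Q.conjTranspose * Q := by
  classical
  exact CStarAlgebra.nonneg_iff_eq_star_mul_self.1 hM.nonneg

omit [DecidableEq A] in
-- With `M = Qᴴ Q`, the inequality `2|ab| ≤ |a|² + |b|²` bounds an entry by the mean of two diagonal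
-- entries. Sets of Choi matrices and of effects are bounded for this reason.
theorem Matrix.PosSemidef.norm_apply_le_trace {M : Matrix A A ℂ} (hM : M.PosSemidef) (i j : A) :
    ‖M i j‖ ≤ M.trace.re := by
  obtain ⟨Q, hQ⟩ := hM.exists_eq_conjTranspose_mul_self
  have hdiag : ∀ i, (M i i).re = ∑ k, ‖Q k i‖ ^ 2 := fun i => by
    rw [hQ, Matrix.mul_apply, Complex.re_sum]
    refine Finset.sum_congr rfl fun k _ => ?_
    rw [Matrix.conjTranspose_apply, Complex.star_def, Complex.conj_mul', ← Complex.ofReal_pow,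
      Complex.ofReal_re]
  have hle : ∀ i, (M i i).re ≤ M.trace.re := fun i => by
    rw [Matrix.trace, Complex.re_sum]
    exact Finset.single_le_sum (f := fun i => (M i i).re)
      (fun i _ => (Complex.nonneg_iff.1 hM.diag_nonneg).1) (Finset.mem_univ i)
  have h : ‖M i j‖ ≤ ((M i i).re + (M j j).re) / 2 := by
    rw [hdiag, hdiag, ← Finset.sum_add_distrib, Finset.sum_div, hQ, Matrix.mul_apply]
    refine norm_sum_le_of_le _ fun k _ => ?_
    rw [Matrix.conjTranspose_apply, norm_mul, norm_star]
    nlinarith [sq_nonneg (‖Q k i‖ - ‖Q k j‖)]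
  linarith [hle i, hle j]

variable [Fintype B]

theorem IsChannel.trace_choi {Φ : SuperOp A B} (hΦ : IsChannel Φ) :
    (choi Φ).trace = Fintype.card A := by
  simp only [Matrix.trace, Matrix.diag_apply, Fintype.sum_prod_type]
  have h : ∀ a, ∑ b, choi Φ (a, b) (a, b) = 1 := fun a => by
    simpa [Matrix.trace, choi] using hΦ.2 (Matrix.single a a 1)
  simp [h]

theorem isCompact_image_choi {S : Set (SuperOp A B)} (hS : IsClosedOps S)
    (hS' : ∀ Φ ∈ S, IsChannel Φ) : IsCompact (choi '' S) := by
  have hK : IsCompact (Set.matrix (Metric.closedBall (0 : ℂ) (Fintype.card A)) :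
      Set (Matrix (A × B) (A × B) ℂ)) := (isCompact_closedBall _ _).matrix
  refine hK.of_isClosed_subset hS ?_
  rintro _ ⟨Φ, hΦ, rfl⟩ p q
  have h := (hS' Φ hΦ).1.posSemidef_choi.norm_apply_le_trace p q
  rw [(hS' Φ hΦ).trace_choi] at h
  simpa using h

omit [DecidableEq A] in
theorem trace_idTensor {R : Type*} [Fintype R] {Φ : SuperOp A B}
    (hΦ : ∀ X : Matrix A A ℂ, (Φ X).trace = X.trace) (X : Matrix (R × A) (R × A) ℂ) :
    (idTensor R Φ X).trace = X.trace := by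
  simp only [Matrix.trace, Matrix.diag_apply, Fintype.sum_prod_type]
  refine Finset.sum_congr rfl fun r _ => ?_
  simpa [Matrix.trace] using hΦ (Matrix.of fun a a' => X (r, a) (r, a'))

end Choi

/-! ### Constructing superchannels -/

section CompletelyPositive

variable {A B C : Type*}

theorem IsCompletelyPositive.add {Φ Ψ : SuperOp A B} (hΦ : IsCompletelyPositive Φ)
    (hΨ : IsCompletelyPositive Ψ) : IsCompletelyPositive (Φ + Ψ) :=
  fun n X hX => (hΦ n X hX).add (hΨ n X hX)

theorem IsCompletelyPositive.comp {Φ : SuperOp B C} {Ψ : SuperOp A B}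
    (hΦ : IsCompletelyPositive Φ) (hΨ : IsCompletelyPositive Ψ) :
    IsCompletelyPositive (Φ ∘ₗ Ψ) :=
  fun n X hX => hΦ n _ (hΨ n X hX)

/-- Relabelling of the basis. -/
def reindexOp (e : A ≃ B) : SuperOp A B where
  toFun X := X.submatrix e.symm e.symm
  map_add' _ _ := rfl
  map_smul' _ _ := rfl

theorem isCompletelyPositive_reindexOp (e : A ≃ B) : IsCompletelyPositive (reindexOp e) :=
  fun _ _ hX => hX.submatrix (Prod.map id e.symm)

variable [Fintype A] [Fintype B] [Fintype C]

theorem isChannel_reindexOp (e : A ≃ B) : IsChannel (reindexOp e) :=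
  ⟨isCompletelyPositive_reindexOp e, fun X => e.symm.sum_comp fun i => X i i⟩

theorem IsChannel.comp {Φ : SuperOp B C} {Ψ : SuperOp A B} (hΦ : IsChannel Φ) (hΨ : IsChannel Ψ) :
    IsChannel (Φ ∘ₗ Ψ) :=
  ⟨hΦ.1.comp hΨ.1, fun X => (hΦ.2 _).trans (hΨ.2 X)⟩

/-- The relabelling of the memory by `Fin n` is absorbed into `pre` and `post`. -/
theorem isSuperchannel_of_fintype {D : Type*} [Fintype D] {R : Type*} [Fintype R]
    {pre : SuperOp C (R × A)} {post : SuperOp (R × B) D} (hpre : IsChannel pre)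
    (hpost : IsChannel post) :
    IsSuperchannel fun L : SuperOp A B => post ∘ₗ idTensor R L ∘ₗ pre := by
  let e := Fintype.equivFin R
  let eA : R × A ≃ Fin (Fintype.card R) × A := e.prodCongr (.refl A)
  let eB : Fin (Fintype.card R) × B ≃ R × B := e.symm.prodCongr (.refl B)
  refine ⟨Fintype.card R, reindexOp eA ∘ₗ pre, post ∘ₗ reindexOp eB,
    (isChannel_reindexOp _).comp hpre, hpost.comp (isChannel_reindexOp _), fun L => ?_⟩
  refine LinearMap.ext fun X => congrArg post ?_
  ext p q
  simp [reindexOp, eA, eB]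

/-- Appending a fixed operator `ρ` on `K ⊗ A` to an operator on `C`, which joins the memory. -/
def appendOp {K : Type*} (ρ : Matrix (K × A) (K × A) ℂ) : SuperOp C ((K × C) × A) where
  toFun X := Matrix.of fun p q => X p.1.2 q.1.2 * ρ (p.1.1, p.2) (q.1.1, q.2)
  map_add' X Y := by ext; simp [add_mul]
  map_smul' c X := by ext; simp [mul_assoc]

theorem isChannel_appendOp {K : Type*} [Fintype K] {ρ : Matrix (K × A) (K × A) ℂ}
    (hρ : ρ.PosSemidef) (hρ' : ρ.trace = 1) :
    IsChannel (appendOp ρ : SuperOp C ((K × C) × A)) := by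
  classical
  refine ⟨fun n X hX => ?_, fun X => ?_⟩
  · exact (hX.kronecker hρ).submatrix
      fun p : Fin n × ((K × C) × A) => ((p.1, p.2.1.2), (p.2.1.1, p.2.2))
  · trans ρ.trace * X.trace
    · simp only [Matrix.trace, Matrix.diag_apply, Fintype.sum_prod_type, appendOp,
        LinearMap.coe_mk, AddHom.coe_mk, Matrix.of_apply, Finset.sum_mul, Finset.mul_sum]
      rw [Finset.sum_comm]
      simp only [mul_comm]
    · rw [hρ', one_mul]

/-- The partial contraction `Y ↦ Tr_{KB} (P Y)` with an operator `P` on `K ⊗ B`. -/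
def contractOp {K : Type*} [Fintype K] (P : Matrix (K × B) (K × B) ℂ) :
    SuperOp ((K × C) × B) C where
  toFun Y := Matrix.of fun c c' => ∑ p : K × B, ∑ q : K × B,
    P q p * Y ((p.1, c), p.2) ((q.1, c'), q.2)
  map_add' X Y := by ext; simp [mul_add, Finset.sum_add_distrib]
  map_smul' c X := by ext; simp [mul_left_comm, Finset.mul_sum]

omit [Fintype A] [Fintype B] [Fintype C] in
-- A factorization `P = Qᴴ Q` gives a Kraus form: row `s` of `Q` defines the operator `L s`, and the
-- contraction is `∑ s, L s * Z * (L s)ᴴ`.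
theorem Matrix.PosSemidef.partialContraction [Finite A] [Fintype B] {P : Matrix B B ℂ}
    (hP : P.PosSemidef) {Z : Matrix (A × B) (A × B) ℂ} (hZ : Z.PosSemidef) :
    (Matrix.of fun a a' => ∑ p, ∑ q, P q p * Z (a, p) (a', q)).PosSemidef := by
  classical
  have := Fintype.ofFinite A
  obtain ⟨Q, rfl⟩ := hP.exists_eq_conjTranspose_mul_self
  let L : B → Matrix A (A × B) ℂ := fun s => Matrix.of fun a y => if a = y.1 then Q s y.2 else 0
  convert Matrix.posSemidef_sum Finset.univ fun s _ => hZ.mul_mul_conjTranspose_same (L s) using 1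
  have h₁ : ∀ s a y, (L s * Z) a y = ∑ p, Q s p * Z (a, p) y := fun s a y => by
    simp [Matrix.mul_apply, L, Fintype.sum_prod_type]
  have h₂ : ∀ s a a', (L s * Z * (L s).conjTranspose) a a' =
      ∑ q, ∑ p, star (Q s q) * Q s p * Z (a, p) (a', q) := fun s a a' => by
    rw [Matrix.mul_apply]
    simp only [h₁, Matrix.conjTranspose_apply, Fintype.sum_prod_type]
    rw [Finset.sum_eq_single a' (fun b _ hb => by simp [L, hb.symm]) (by simp)]
    refine Finset.sum_congr rfl fun q _ => ?_
    rw [Finset.sum_mul]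
    refine Finset.sum_congr rfl fun p _ => ?_
    simp [L]
    ring
  ext a a'
  simp only [Matrix.of_apply, Matrix.sum_apply, h₂, Matrix.mul_apply, Matrix.conjTranspose_apply,
    Finset.sum_mul]
  rw [Finset.sum_comm, Finset.sum_comm (s := Finset.univ (α := B))]
  conv_lhs => enter [2, q]; rw [Finset.sum_comm]
  conv_lhs => rw [Finset.sum_comm]
  exact Finset.sum_congr rfl fun s _ => Finset.sum_comm

omit [Fintype A] in
theorem isCompletelyPositive_contractOp {K : Type*} [Fintype K] {P : Matrix (K × B) (K × B) ℂ}
    (hP : P.PosSemidef) : IsCompletelyPositive (contractOp P : SuperOp ((K × C) × B) C) := by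
  intro n Y hY
  let f : (Fin n × C) × (K × B) → Fin n × ((K × C) × B) :=
    fun p => (p.1.1, ((p.2.1, p.1.2), p.2.2))
  have h := hP.partialContraction (hY.submatrix f)
  have h' : idTensor (Fin n) (contractOp P) Y = Matrix.of fun a a' => ∑ p, ∑ q,
      P q p * (Y.submatrix f f) (a, p) (a', q) := by
    ext a a'
    rfl
  rwa [h']

omit [Fintype A] [Fintype C] in
-- The system `C` only waits in the memory, so `X` factors out by linearity and the test leaves the
-- scalar acceptance probability.
theorem contractOp_idTensor_appendOp {K : Type*} [Fintype K] (P : Matrix (K × B) (K × B) ℂ)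
    (ρ : Matrix (K × A) (K × A) ℂ) (L : SuperOp A B) (X : Matrix C C ℂ) :
    contractOp P (idTensor (K × C) L (appendOp ρ X)) = (P * idTensor K L ρ).trace • X := by
  ext c c'
  have h : ∀ p q : K × B, idTensor (K × C) L (appendOp ρ X) ((p.1, c), p.2) ((q.1, c'), q.2) =
      X c c' * idTensor K L ρ p q := fun p q => congrFun (congrFun (L.map_smul (X c c')
      (Matrix.of fun a a' => ρ (p.1, a) (q.1, a'))) p.2) q.2
  change ∑ p : K × B, ∑ q : K × B, P q p * _ = _
  simp only [h, Matrix.trace, Matrix.diag_apply, Matrix.mul_apply, Matrix.smul_apply, smul_eq_mul,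
    Finset.sum_mul]
  rw [Finset.sum_comm]
  exact Finset.sum_congr rfl fun p _ => Finset.sum_congr rfl fun q _ => by ring

theorem trace_contractOp_add {K : Type*} [Fintype K] [DecidableEq K] [DecidableEq B]
    (P : Matrix (K × B) (K × B) ℂ) (Y : Matrix ((K × C) × B) ((K × C) × B) ℂ) :
    (contractOp P Y).trace + (contractOp (1 - P) Y).trace = Y.trace := by
  rw [← Matrix.trace_add]
  have : contractOp P Y + contractOp (1 - P) Y = Matrix.of fun c c' => ∑ p : K × B,
      Y ((p.1, c), p.2) ((p.1, c'), p.2) := by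
    ext c c'
    simp only [contractOp, LinearMap.coe_mk, AddHom.coe_mk, Matrix.add_apply, Matrix.of_apply,
      ← Finset.sum_add_distrib, ← add_mul, Matrix.sub_apply, add_sub_cancel, Matrix.one_apply,
      ite_mul, one_mul, zero_mul, Finset.sum_ite_eq', Finset.mem_univ, if_true]
  rw [this]
  simp only [Matrix.trace, Matrix.diag_apply, Matrix.of_apply, Fintype.sum_prod_type]
  rw [Finset.sum_comm]

/-- Measuring the image of a state under `L` with a binary test and preparing one of two channels
according to the outcome is a superchannel. -/
theorem exists_isSuperchannel_of_test {D K : Type*} [Fintype D] [Fintype K] [DecidableEq K]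
    [DecidableEq B]
    {ρ : Matrix (K × A) (K × A) ℂ} (hρ : ρ.PosSemidef) (hρ' : ρ.trace = 1)
    {P : Matrix (K × B) (K × B) ℂ} (hP : P.PosSemidef) (hP' : (1 - P).PosSemidef)
    {Φ Ψ : SuperOp C D} (hΦ : IsChannel Φ) (hΨ : IsChannel Ψ) :
    ∃ Θ : SuperOp A B → SuperOp C D, IsSuperchannel Θ ∧
      ∀ L, Θ L = (P * idTensor K L ρ).trace • Φ + ((1 - P) * idTensor K L ρ).trace • Ψ := by
  let post : SuperOp ((K × C) × B) D := Φ ∘ₗ contractOp P + Ψ ∘ₗ contractOp (1 - P)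
  have hpost : IsChannel post := by
    refine ⟨(hΦ.1.comp (isCompletelyPositive_contractOp hP)).add
      (hΨ.1.comp (isCompletelyPositive_contractOp hP')), fun Y => ?_⟩
    change (Φ (contractOp P Y) + Ψ (contractOp (1 - P) Y)).trace = _
    rw [Matrix.trace_add, hΦ.2, hΨ.2, trace_contractOp_add]
  refine ⟨_, isSuperchannel_of_fintype (isChannel_appendOp hρ hρ') hpost, fun L => ?_⟩
  refine LinearMap.ext fun X => ?_
  change Φ (contractOp P _) + Ψ (contractOp (1 - P) _) = _
  simp only [LinearMap.comp_apply, contractOp_idTensor_appendOp, map_smul]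
  rfl

theorem Matrix.posSemidef_blockDiagonal {ι X : Type*} [Fintype ι] [Fintype X] [DecidableEq ι]
    {M : ι → Matrix X X ℂ} (hM : ∀ i, (M i).PosSemidef) : (Matrix.blockDiagonal M).PosSemidef := by
  choose Q hQ using fun i => (hM i).exists_eq_conjTranspose_mul_self
  have : Matrix.blockDiagonal M =
      (Matrix.blockDiagonal Q).conjTranspose * Matrix.blockDiagonal Q := by
    rw [Matrix.blockDiagonal_conjTranspose, ← Matrix.blockDiagonal_mul]
    exact congrArg _ (funext hQ)
  rw [this]
  exact Matrix.posSemidef_conjTranspose_mul_self _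

/-- The operator `⨁ i, M i`, with the label `i` joining the first tensor factor. -/
def flagged {ι K A : Type*} [DecidableEq ι] (M : ι → Matrix (K × A) (K × A) ℂ) :
    Matrix ((K × ι) × A) ((K × ι) × A) ℂ :=
  (Matrix.blockDiagonal M).submatrix (fun p => ((p.1.1, p.2), p.1.2))
    (fun p => ((p.1.1, p.2), p.1.2))

omit [Fintype A] [Fintype B] in
-- The label is a classical register held in the reference; off-diagonal blocks vanish and stay zero
-- under `L`.
theorem idTensor_flagged {ι K : Type*} [DecidableEq ι] (M : ι → Matrix (K × A) (K × A) ℂ)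
    (L : SuperOp A B) : idTensor (K × ι) L (flagged M) = flagged fun i => idTensor K L (M i) := by
  ext p q
  obtain ⟨⟨k, i⟩, b⟩ := p
  obtain ⟨⟨k', j⟩, b'⟩ := q
  by_cases h : i = j
  · subst h
    simp [flagged, Matrix.blockDiagonal_apply]
  · have : (Matrix.of fun _ _ : A => (0 : ℂ)) = 0 := rfl
    simp [flagged, Matrix.blockDiagonal_apply, h, this]

/-- Interchanging the last two factors of a triple product. -/
def flagEquiv (K ι A : Type*) : (K × ι) × A ≃ (K × A) × ι where
  toFun p := ((p.1.1, p.2), p.1.2)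
  invFun p := ((p.1.1, p.2), p.1.2)

omit [Fintype B] in
theorem trace_flagged {ι K : Type*} [Fintype ι] [Fintype K] [DecidableEq ι]
    (M : ι → Matrix (K × A) (K × A) ℂ) : (flagged M).trace = ∑ i, (M i).trace := by
  rw [← Matrix.trace_blockDiagonal]
  exact (flagEquiv K ι A).sum_comp fun i => Matrix.blockDiagonal M i i

theorem flagged_mul {ι K : Type*} [Fintype ι] [Fintype K] [DecidableEq ι]
    (M N : ι → Matrix (K × A) (K × A) ℂ) : flagged M * flagged N = flagged fun i => M i * N i := by
  unfold flagged
  rw [Matrix.blockDiagonal_mul]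
  exact Matrix.submatrix_mul_equiv _ _ _ (flagEquiv K ι A) _

/-- A convex combination of binary tests, used to choose one of two channels to be prepared, is a
superchannel. -/
theorem exists_isSuperchannel_of_tests {D K ι : Type*} [Fintype D] [Fintype K] [DecidableEq K]
    [DecidableEq B] [Fintype ι] {w : ι → ℝ} (hw : ∀ i, 0 ≤ w i) (hw' : ∑ i, w i = 1)
    {ρ : ι → Matrix (K × A) (K × A) ℂ} (hρ : ∀ i, (ρ i).PosSemidef) (hρ' : ∀ i, (ρ i).trace = 1)
    {P : ι → Matrix (K × B) (K × B) ℂ} (hP : ∀ i, (P i).PosSemidef)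
    (hP' : ∀ i, (1 - P i).PosSemidef)
    {Φ Ψ : SuperOp C D} (hΦ : IsChannel Φ) (hΨ : IsChannel Ψ) :
    ∃ Θ : SuperOp A B → SuperOp C D, IsSuperchannel Θ ∧
      ∀ L, Θ L = (∑ i, w i * (P i * idTensor K L (ρ i)).trace) • Φ +
        (∑ i, w i * ((1 - P i) * idTensor K L (ρ i)).trace) • Ψ := by
  classical
  have hone : (1 : Matrix ((K × ι) × B) ((K × ι) × B) ℂ) - flagged P =
      flagged fun i => 1 - P i := by
    unfold flagged
    have : (fun i => 1 - P i) = 1 - P := rfl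
    rw [this, Matrix.blockDiagonal_sub, Matrix.blockDiagonal_one]
    ext p q
    simp [Matrix.one_apply, Prod.ext_iff, and_right_comm]
  -- The weights go into the flagged state, so reading the label samples the test `P i` with
  -- probability `w i`.
  have hps : (flagged fun i => (w i : ℂ) • ρ i).PosSemidef :=
    (Matrix.posSemidef_blockDiagonal fun i =>
      (hρ i).smul (Complex.zero_le_real.2 (hw i))).submatrix _
  have htr : (flagged fun i => (w i : ℂ) • ρ i).trace = 1 := by
    rw [trace_flagged]
    simp [hρ', ← Complex.ofReal_sum, hw']
  obtain ⟨Θ, hΘ, h⟩ := exists_isSuperchannel_of_test hps htr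
    (P := flagged P) ((Matrix.posSemidef_blockDiagonal hP).submatrix _)
    (hone ▸ (Matrix.posSemidef_blockDiagonal hP').submatrix _) hΦ hΨ
  refine ⟨Θ, hΘ, fun L => ?_⟩
  rw [h, hone, idTensor_flagged, flagged_mul, flagged_mul, trace_flagged, trace_flagged]
  simp only [map_smul, Matrix.mul_smul, Matrix.trace_smul, smul_eq_mul]

end CompletelyPositive

/-! ### Convexity and minimax -/

section Minimax

/-- By Carathéodory, `finrank + 1` points suffice, so the hull is a continuous image of a simplex
times a power of `s`. -/
theorem IsCompact.convexHull_of_finiteDimensional {E : Type*} [AddCommGroup E] [Module ℝ E]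
    [TopologicalSpace E] [IsTopologicalAddGroup E] [ContinuousSMul ℝ E] [FiniteDimensional ℝ E]
    {s : Set E} (hs : IsCompact s) : IsCompact (convexHull ℝ s) := by
  rcases s.eq_empty_or_nonempty with rfl | ⟨x₀, hx₀⟩
  · simp
  let d := Module.finrank ℝ E + 1
  let f : (Fin d → ℝ) × (Fin d → E) → E := fun p => ∑ i, p.1 i • p.2 i
  have hf : Continuous f := by fun_prop
  have hK := ((isCompact_stdSimplex ℝ (Fin d)).prod
    (isCompact_univ_pi fun _ : Fin d => hs)).image hf
  convert hK using 1
  ext x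
  constructor
  · intro hx
    obtain ⟨ι, _, z, w, hz, hind, hw, hw', rfl⟩ := eq_pos_convex_span_of_mem_convexHull hx
    obtain ⟨e⟩ : Nonempty (ι ↪ Fin d) := Function.Embedding.nonempty_of_card_le (by
      simpa [d] using hind.card_le_finrank_succ.trans
        (Nat.succ_le_succ (Submodule.finrank_le _)))
    have hout : ∀ j ∉ Set.range e, Function.extend e w 0 j = 0 := fun j hj =>
      Function.extend_apply' _ _ _ hj
    -- Pad with zero weights, attached to the arbitrary point `x₀`, up to exactly `d` points.
    refine ⟨(Function.extend e w 0, Function.extend e z fun _ => x₀), ⟨⟨fun j => ?_, ?_⟩, ?_⟩, ?_⟩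
    · by_cases hj : j ∈ Set.range e
      · obtain ⟨i, rfl⟩ := hj
        simpa [e.injective.extend_apply] using (hw i).le
      · simp [hout j hj]
    · rw [← hw']
      exact (Fintype.sum_of_injective e e.injective _ _ hout fun i => by
        simp [e.injective.extend_apply]).symm
    · intro j _
      by_cases hj : j ∈ Set.range e
      · obtain ⟨i, rfl⟩ := hj
        simpa [e.injective.extend_apply] using hz ⟨i, rfl⟩
      · simpa [Function.extend_apply' _ _ _ hj] using hx₀
    · exact (Fintype.sum_of_injective e e.injective _ _ (fun j hj => by simp [hout j hj])
        fun i => by simp [e.injective.extend_apply]).symm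
  · rintro ⟨⟨w, z⟩, ⟨hw, hz⟩, rfl⟩
    exact mem_convexHull_of_exists_fintype w z hw.1 hw.2 (fun i => hz i trivial) rfl

/-- Sion's theorem gives a saddle point `(a, b)`: `f a y ≤ f x b` for all `x`, `y`. Taking for `x`
the good reply to `b` shows that `a` works against every `y`. -/
theorem exists_mem_convexHull_forall_le {E F : Type*}
    [AddCommGroup E] [Module ℝ E] [TopologicalSpace E] [IsTopologicalAddGroup E]
    [ContinuousSMul ℝ E] [FiniteDimensional ℝ E] [T2Space E]
    [AddCommGroup F] [Module ℝ F] [TopologicalSpace F] [IsTopologicalAddGroup F]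
    [ContinuousSMul ℝ F] [FiniteDimensional ℝ F] [T2Space F]
    (f : E →ₗ[ℝ] F →ₗ[ℝ] ℝ) {S : Set E} (hS : IsCompact S) {Y : Set F} (hY : IsCompact Y)
    (hYc : Convex ℝ Y) (hYne : Y.Nonempty) {c : ℝ} (h : ∀ y ∈ Y, ∃ x ∈ S, f x y ≤ c) :
    ∃ x ∈ convexHull ℝ S, ∀ y ∈ Y, f x y ≤ c := by
  obtain ⟨y₀, hy₀⟩ := hYne
  obtain ⟨x₀, hx₀, -⟩ := h y₀ hy₀
  have hconv : Convex ℝ (convexHull ℝ S) := convex_convexHull ℝ S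
  obtain ⟨a, ha, b, hb, hab⟩ := Sion.exists_isSaddlePointOn (f := fun x y => f x y)
    (X := convexHull ℝ S) (Y := Y)
    ⟨x₀, subset_convexHull ℝ S hx₀⟩ hconv hS.convexHull_of_finiteDimensional
    (fun y _ => (f.flip y).continuous_of_finiteDimensional.lowerSemicontinuous.lowerSemicontinuousOn _)
    (fun y _ => ((f.flip y).convexOn hconv).quasiconvexOn)
    hYc ⟨y₀, hy₀⟩ hY
    (fun x _ => (f x).continuous_of_finiteDimensional.upperSemicontinuous.upperSemicontinuousOn _)
    (fun x _ => ((f x).concaveOn hYc).quasiconcaveOn)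
  obtain ⟨x, hx, hxc⟩ := h b hb
  exact ⟨a, ha, fun y hy => (hab x (subset_convexHull ℝ S hx) y hy).trans hxc⟩

end Minimax

/-! ### Positive semidefinite matrices -/

section PosSemidef

variable {X : Type*} [Fintype X]

theorem Matrix.PosSemidef.trace_mul_nonneg {M N : Matrix X X ℂ} (hM : M.PosSemidef)
    (hN : N.PosSemidef) : 0 ≤ (M * N).trace := by
  obtain ⟨Q, rfl⟩ := hM.exists_eq_conjTranspose_mul_self
  rw [Matrix.mul_assoc, Matrix.trace_mul_comm]
  exact (hN.mul_mul_conjTranspose_same Q).trace_nonneg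

theorem Matrix.PosSemidef.trace_mul_mem_Icc [DecidableEq X] {P ρ : Matrix X X ℂ}
    (hP : P.PosSemidef) (hP' : (1 - P).PosSemidef) (hρ : ρ.PosSemidef) (hρ' : ρ.trace = 1) :
    (P * ρ).trace = ((P * ρ).trace.re : ℂ) ∧ 0 ≤ (P * ρ).trace.re ∧ (P * ρ).trace.re ≤ 1 := by
  have h₁ := Complex.nonneg_iff.1 (hP.trace_mul_nonneg hρ)
  have h₂ := Complex.nonneg_iff.1 (hP'.trace_mul_nonneg hρ)
  rw [sub_mul, one_mul, Matrix.trace_sub, hρ'] at h₂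
  refine ⟨Complex.ext (by simp) (by simpa using h₁.2.symm), h₁.1, ?_⟩
  have := h₂.1
  simp only [Complex.sub_re, Complex.one_re] at this
  linarith

theorem Matrix.isClosed_setOf_posSemidef : IsClosed {M : Matrix X X ℂ | M.PosSemidef} := by
  simp only [Matrix.posSemidef_iff_dotProduct_mulVec, Set.ofPred_and, Set.ofPred_forall]
  refine IsClosed.inter (isClosed_eq continuous_id.matrix_conjTranspose continuous_id) ?_
  refine isClosed_iInter fun x => isClosed_le continuous_const ?_
  exact continuous_const.dotProduct (continuous_id.matrix_mulVec continuous_const)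

theorem Matrix.isCompact_effects [DecidableEq X] :
    IsCompact {P : Matrix X X ℂ | P.PosSemidef ∧ (1 - P).PosSemidef} := by
  have hK : IsCompact (Set.matrix (Metric.closedBall (0 : ℂ) (Fintype.card X)) :
      Set (Matrix X X ℂ)) := (isCompact_closedBall _ _).matrix
  refine hK.of_isClosed_subset (Matrix.isClosed_setOf_posSemidef.inter
    (Matrix.isClosed_setOf_posSemidef.preimage (continuous_const.sub continuous_id))) ?_
  rintro P ⟨hP, hP'⟩ i j
  have h₁ := hP.norm_apply_le_trace i j
  have h₂ := (Complex.nonneg_iff.1 hP'.trace_nonneg).1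
  simp only [Matrix.trace_sub, Matrix.trace_one, Complex.sub_re, Complex.natCast_re] at h₂
  rw [mem_closedBall_zero_iff]
  linarith

/-- A finite spectrum makes every function admissible for `cfc`, including the discontinuous one
defining `supportProj`. -/
theorem Matrix.continuousOn_spectrum [DecidableEq X] (M : Matrix X X ℂ)
    (f : ℝ → ℝ) : ContinuousOn f (spectrum ℝ M) :=
  Matrix.finite_real_spectrum.continuousOn f

theorem supportProj_mul_supportProj [DecidableEq X] (ρ : Matrix X X ℂ) :
    supportProj ρ * supportProj ρ = supportProj ρ := by
  unfold supportProj
  rw [← cfc_mul _ _ ρ (ρ.continuousOn_spectrum _) (ρ.continuousOn_spectrum _)]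
  congr 1
  ext x
  split_ifs <;> simp

theorem supportProj_mul_self [DecidableEq X] {ρ : Matrix X X ℂ} (hρ : ρ.IsHermitian) :
    supportProj ρ * ρ = ρ := by
  have hid : cfc (id : ℝ → ℝ) ρ = ρ := cfc_id ℝ ρ hρ
  unfold supportProj
  conv_lhs => enter [2]; rw [← hid]
  conv_rhs => rw [← hid]
  rw [← cfc_mul _ _ ρ (ρ.continuousOn_spectrum _) (ρ.continuousOn_spectrum _)]
  congr 1
  ext x
  by_cases hx : x = 0 <;> simp [hx]

theorem posSemidef_supportProj [DecidableEq X] (ρ : Matrix X X ℂ) :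
    (supportProj ρ).PosSemidef := by
  have h : (supportProj ρ).conjTranspose * supportProj ρ = supportProj ρ := by
    rw [supportProj, conjTranspose_cfc]
    exact supportProj_mul_supportProj ρ
  exact h ▸ Matrix.posSemidef_conjTranspose_mul_self _

theorem posSemidef_one_sub_supportProj [DecidableEq X] (ρ : Matrix X X ℂ) :
    (1 - supportProj ρ).PosSemidef := by
  have h : (1 - supportProj ρ).conjTranspose * (1 - supportProj ρ) = 1 - supportProj ρ := by
    rw [Matrix.conjTranspose_sub, Matrix.conjTranspose_one, supportProj, conjTranspose_cfc,
      ← supportProj]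
    simp only [sub_mul, mul_sub, one_mul, mul_one, supportProj_mul_supportProj ρ, sub_self,
      sub_zero]
  exact h ▸ Matrix.posSemidef_conjTranspose_mul_self _

end PosSemidef

/-! ### Tests that accept the image of a channel with certainty -/

section PureVec

variable {A B : Type*} [Fintype A]

/-- The operator `|v⟩⟨v|`. -/
def outerProduct {X : Type*} (v : EuclideanSpace ℂ X) : Matrix X X ℂ :=
  Matrix.vecMulVec (fun x => v x) (fun x => star (v x))

theorem continuous_outerProduct {X : Type*} :
    Continuous (outerProduct : EuclideanSpace ℂ X → Matrix X X ℂ) := by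
  have h : Continuous fun v : EuclideanSpace ℂ X => fun x => v x :=
    continuous_pi fun x => by fun_prop
  exact h.matrix_vecMulVec (continuous_star.comp h)

theorem PureVec.posSemidef_proj (v : PureVec A) : v.proj.PosSemidef :=
  Matrix.posSemidef_vecMulVec_self_star _

theorem PureVec.trace_proj (v : PureVec A) : v.proj.trace = 1 := by
  have h := EuclideanSpace.norm_sq_eq v.1
  rw [v.2, one_pow] at h
  have h' : ∀ x, v.1 x * star (v.1 x) = ((‖v.1 x‖ ^ 2 : ℝ) : ℂ) := fun x => by
    rw [Complex.star_def, Complex.mul_conj', Complex.ofReal_pow]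
  simp only [PureVec.proj, Matrix.trace, Matrix.diag_apply, Matrix.vecMulVec_apply, h',
    ← Complex.ofReal_sum, ← h, Complex.ofReal_one]

instance PureVec.instNonempty [DecidableEq A] [Nonempty A] : Nonempty (PureVec A) := by
  obtain ⟨a⟩ := ‹Nonempty A›
  exact ⟨⟨EuclideanSpace.single (a, a) 1, by simp⟩⟩

variable [Fintype B] {Φ : SuperOp A B}

theorem IsChannel.posSemidef_idTensor_proj (hΦ : IsChannel Φ) (v : PureVec A) :
    (idTensor A Φ v.proj).PosSemidef :=
  hΦ.1.posSemidef_idTensor v.posSemidef_proj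

theorem IsChannel.trace_idTensor_proj (hΦ : IsChannel Φ) (v : PureVec A) :
    (idTensor A Φ v.proj).trace = 1 := by
  rw [trace_idTensor hΦ.2, v.trace_proj]

end PureVec

section Tests

variable {A B : Type*} [Fintype A] [DecidableEq A] [Fintype B]

/-- The real bilinear pairing `(W, J) ↦ Re ∑ x y, W x y * J x y` of matrices. -/
def realPairing (X : Type*) [Fintype X] :
    Matrix X X ℂ →ₗ[ℝ] Matrix X X ℂ →ₗ[ℝ] ℝ :=
  LinearMap.mk₂ ℝ (fun W J => (∑ x, ∑ y, W x y * J x y).re)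
    (fun W W' J => by simp [add_mul, Finset.sum_add_distrib])
    (fun c W J => by simp [mul_assoc, Finset.mul_sum, mul_sub])
    (fun W J J' => by simp [mul_add, Finset.sum_add_distrib])
    (fun c W J => by simp [mul_left_comm, Finset.mul_sum, mul_sub])

/-- The matrix representing, on Choi matrices, the functional `L ↦ Tr (P (id ⊗ L)(ρ))`. -/
def testMatrix {K : Type*} [Fintype K] (ρ : Matrix (K × A) (K × A) ℂ)
    (P : Matrix (K × B) (K × B) ℂ) : Matrix (A × B) (A × B) ℂ :=
  Matrix.of fun x y => ∑ r, ∑ r', P (r', y.2) (r, x.2) * ρ (r, x.1) (r', y.1)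

theorem realPairing_testMatrix {K : Type*} [Fintype K] (ρ : Matrix (K × A) (K × A) ℂ)
    (P : Matrix (K × B) (K × B) ℂ) (L : SuperOp A B) :
    realPairing (A × B) (testMatrix ρ P) (choi L) = (P * idTensor K L ρ).trace.re := by
  refine congrArg Complex.re ?_
  simp only [Matrix.trace, Matrix.diag_apply, Matrix.mul_apply, idTensor_apply_eq_sum_choi,
    testMatrix, Matrix.of_apply, Finset.sum_mul, Finset.mul_sum, Fintype.sum_prod_type]
  simp only [← Fintype.sum_prod_type']
  refine Fintype.sum_equiv
    -- Only a permutation of the six summation indices.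
    { toFun := fun x => (x.2.2.2.2.2, x.2.2.2.1, x.2.2.2.2.1, x.2.1, x.1, x.2.2.1)
      invFun := fun x => (x.2.2.2.2.1, x.2.2.2.1, x.2.2.2.2.2, x.2.1, x.2.2.1, x.1)
      left_inv := fun _ => rfl
      right_inv := fun _ => rfl } _ _ fun x => ?_
  exact mul_assoc _ _ _

omit [Fintype B] in
theorem continuous_idTensor {K : Type*} (Φ : SuperOp A B) : Continuous (idTensor K Φ) := by
  refine continuous_matrix fun p q => ?_
  simp only [idTensor_apply_eq_sum_choi]
  exact continuous_finsetSum _ fun a _ => continuous_finsetSum _ fun a' _ =>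
    (continuous_id.matrix_elem _ _).mul continuous_const

theorem continuous_testValue (Φ : SuperOp A B) :
    Continuous fun p : EuclideanSpace ℂ (A × A) × Matrix (A × B) (A × B) ℂ =>
      (p.2 * idTensor A Φ (outerProduct p.1)).trace.re :=
  Complex.continuous_re.comp (continuous_snd.matrix_mul
    ((continuous_idTensor Φ).comp (continuous_outerProduct.comp continuous_fst))).matrix_trace

variable [DecidableEq B]

/-- Pairs of a pure input state and an effect which accepts the output of `Φ` with certainty. -/
def perfectTests (Φ : SuperOp A B) :
    Set (EuclideanSpace ℂ (A × A) × Matrix (A × B) (A × B) ℂ) :=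
  {p | ‖p.1‖ = 1 ∧ (p.2.PosSemidef ∧ (1 - p.2).PosSemidef) ∧
    1 ≤ (p.2 * idTensor A Φ (outerProduct p.1)).trace.re}

theorem isCompact_perfectTests (Φ : SuperOp A B) : IsCompact (perfectTests Φ) := by
  have h := ((isCompact_sphere (0 : EuclideanSpace ℂ (A × A)) 1).prod
    (Matrix.isCompact_effects (X := A × B))).inter_right
      (isClosed_le continuous_const (continuous_testValue Φ) (f := fun _ => (1 : ℝ)))
  convert h using 1
  ext p
  simp [perfectTests, and_assoc]

theorem perfectTests_nonempty [Nonempty A] {Φ : SuperOp A B} (hΦ : IsChannel Φ) :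
    (perfectTests Φ).Nonempty := by
  obtain ⟨v⟩ : Nonempty (PureVec A) := inferInstance
  refine ⟨(v.1, 1), v.2, ⟨Matrix.PosSemidef.one, by simpa using Matrix.PosSemidef.zero⟩, ?_⟩
  have h := hΦ.trace_idTensor_proj v
  change 1 ≤ (1 * idTensor A Φ v.proj).trace.re
  rw [one_mul, h, Complex.one_re]

theorem le_hypTest {X : Type*} [Fintype X] [DecidableEq X] {ε : ℝ} {ρ σ P : Matrix X X ℂ}
    (hP : P.PosSemidef) (hP' : (1 - P).PosSemidef) (h : 1 - ε ≤ (P * ρ).trace.re) :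
    (ENNReal.ofReal (P * σ).trace.re)⁻¹ ≤ hypTest ε ρ σ :=
  le_iSup₂_of_le P hP (le_iSup₂_of_le hP' h le_rfl)

/-- Compactness of the perfect tests turns the supremum in `Rmin` into an attained minimum of the
acceptance probability. -/
theorem exists_perfectTest_le [Nonempty A] {O : Set (SuperOp A B)} {Φ M : SuperOp A B}
    (hΦ : IsChannel Φ) {k : ℝ} (hk : 0 < k) (h : ENNReal.ofReal k ≤ Rmin O Φ) (hM : M ∈ O) :
    ∃ p ∈ perfectTests Φ, (p.2 * idTensor A M (outerProduct p.1)).trace.re ≤ k⁻¹ := by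
  obtain ⟨p, hp, hmin⟩ := (isCompact_perfectTests Φ).exists_isMinOn (perfectTests_nonempty hΦ)
    (continuous_testValue M).continuousOn
  refine ⟨p, hp, ?_⟩
  have h' : ENNReal.ofReal k ≤
      (ENNReal.ofReal (p.2 * idTensor A M (outerProduct p.1)).trace.re)⁻¹ := by
    refine h.trans ((iInf₂_le M hM).trans (iSup_le fun v => iSup₂_le fun P hP =>
      iSup₂_le fun hP' hP₁ => ENNReal.inv_le_inv.2 (ENNReal.ofReal_le_ofReal ?_)))
    exact hmin (show ((v.1, P) : EuclideanSpace ℂ (A × A) × _) ∈ perfectTests Φ from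
      ⟨v.2, ⟨hP, hP'⟩, (sub_zero (1 : ℝ)).symm.trans_le hP₁⟩)
  rw [ENNReal.le_inv_iff_le_inv, ← ENNReal.ofReal_inv_of_pos hk,
    ENNReal.ofReal_le_ofReal_iff (inv_nonneg.2 hk.le)] at h'
  exact h'

/-- Here the order of quantifiers is reversed: one mixture of tests serves all free `M`. Tests enter
linearly through `testMatrix`, and a point of the convex hull of test matrices is such a mixture. -/
theorem exists_tests_of_le_Rmin [Nonempty A] (𝓡 : ResourceTheory A B) {Φ : SuperOp A B}
    (hΦ : IsChannel Φ) {k : ℝ} (hk : 0 < k) (h : ENNReal.ofReal k ≤ Rmin 𝓡.free Φ)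
    (hne : 𝓡.free.Nonempty) :
    ∃ (ι : Type) (_ : Fintype ι) (w : ι → ℝ)
      (p : ι → EuclideanSpace ℂ (A × A) × Matrix (A × B) (A × B) ℂ),
      (∀ i, 0 ≤ w i) ∧ ∑ i, w i = 1 ∧ (∀ i, p i ∈ perfectTests Φ) ∧
      ∀ M ∈ 𝓡.free, ∑ i, w i * ((p i).2 * idTensor A M (outerProduct (p i).1)).trace.re ≤ k⁻¹ := by
  let F : EuclideanSpace ℂ (A × A) × Matrix (A × B) (A × B) ℂ → Matrix (A × B) (A × B) ℂ :=
    fun p => testMatrix (outerProduct p.1) p.2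
  have hF : Continuous F := by
    refine continuous_matrix fun x y => ?_
    exact continuous_finsetSum _ fun r _ => continuous_finsetSum _ fun r' _ =>
      (continuous_snd.matrix_elem _ _).mul
        ((continuous_outerProduct.comp continuous_fst).matrix_elem _ _)
  obtain ⟨W, hW, hle⟩ := exists_mem_convexHull_forall_le (realPairing (A × B))
    ((isCompact_perfectTests Φ).image hF)
    (isCompact_image_choi 𝓡.isClosed_free
      fun M hM => 𝓡.isChannel_of_mem_all M (𝓡.free_subset_all hM))
    (convex_image_choi 𝓡.convex_free) (hne.image _) (c := k⁻¹) (by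
      rintro _ ⟨M, hM, rfl⟩
      obtain ⟨p, hp, hpM⟩ := exists_perfectTest_le hΦ hk h hM
      exact ⟨F p, ⟨p, hp, rfl⟩, by rwa [realPairing_testMatrix]⟩)
  obtain ⟨ι, _, w, z, hw, hw', hz, rfl⟩ := mem_convexHull_iff_exists_fintype.1 hW
  choose p hp hpz using hz
  refine ⟨ι, _, w, p, hw, hw', hp, fun M hM => ?_⟩
  have := hle _ ⟨M, hM, rfl⟩
  simpa only [map_sum, map_smul, LinearMap.sum_apply, LinearMap.smul_apply, ← hpz,
    F, realPairing_testMatrix, smul_eq_mul] using this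

end Tests

/-! ### Comparison of the measures -/

section Measures

variable {A B : Type*} [Fintype A] [DecidableEq A] [Fintype B]

theorem re_trace_mul_idTensor_combo {K : Type*} [Fintype K] (ρ : Matrix (K × A) (K × A) ℂ)
    (P : Matrix (K × B) (K × B) ℂ) (a b : ℝ) (L M : SuperOp A B) :
    (P * idTensor K (a • L + b • M) ρ).trace.re =
      a * (P * idTensor K L ρ).trace.re + b * (P * idTensor K M ρ).trace.re := by
  simp only [← realPairing_testMatrix, choi_add, choi_smul, map_add, map_smul, smul_eq_mul]

variable [DecidableEq B]

theorem IsChannel.one_le_supportProj {Φ : SuperOp A B} (hΦ : IsChannel Φ) (v : PureVec A) :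
    1 ≤ (supportProj (idTensor A Φ v.proj) * idTensor A Φ v.proj).trace.re := by
  rw [supportProj_mul_self (hΦ.posSemidef_idTensor_proj v).1, hΦ.trace_idTensor_proj,
    Complex.one_re]

/-- The support projection is one of the perfect tests, and a free channel is one point of the
affine hull. -/
theorem RminAff_le_Rmin {Φ : SuperOp A B} (hΦ : IsChannel Φ) (O : Set (SuperOp A B)) :
    RminAff O Φ ≤ Rmin O Φ := by
  refine le_iInf₂ fun M hM => ?_
  rw [RminAff, ENNReal.inv_le_iff_inv_le]
  refine le_iInf fun v => ?_
  refine le_trans ?_ (le_iSup₂ (f := fun (M : SuperOp A B) (_ : M ∈ affineSpan ℝ O) =>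
    ENNReal.ofReal (supportProj (idTensor A Φ v.proj) * idTensor A M v.proj).trace.re) M
    (subset_affineSpan ℝ O hM))
  rw [ENNReal.inv_le_iff_inv_le]
  refine le_trans ?_ (le_iSup (fun v : PureVec A =>
    hypTest 0 (idTensor A Φ v.proj) (idTensor A M v.proj)) v)
  exact le_hypTest (posSemidef_supportProj _) (posSemidef_one_sub_supportProj _)
    ((sub_zero (1 : ℝ)).trans_le (hΦ.one_le_supportProj v))

/-- A test passed by `Φ` with certainty is passed by `(Φ + r M)/(1 + r)` with probability at least
`1/(1 + r)`. -/
theorem Rmin_le_robustness {O O' : Set (SuperOp A B)} (hO' : ∀ M ∈ O', IsChannel M)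
    (Φ : SuperOp A B) : Rmin O Φ ≤ robustness O O' Φ := by
  refine le_iInf fun r => le_iInf₂ fun M hM => le_iInf fun h => ?_
  refine (iInf₂_le _ h).trans (iSup_le fun v => iSup₂_le fun P hP => iSup₂_le fun hP' hP₁ => ?_)
  have hr : (0 : ℝ) < 1 + r := by positivity
  have hpos := (hP.trace_mul_mem_Icc hP' ((hO' M hM).posSemidef_idTensor_proj v)
    ((hO' M hM).trace_idTensor_proj v)).2.1
  have hge : (1 + (r : ℝ))⁻¹ ≤
      (P * idTensor A ((1 + (r : ℝ))⁻¹ • (Φ + (r : ℝ) • M)) v.proj).trace.re := by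
    rw [smul_add, smul_smul, re_trace_mul_idTensor_combo]
    rw [sub_zero] at hP₁
    have h₁ := mul_le_mul_of_nonneg_left hP₁ (inv_nonneg.2 hr.le)
    have h₂ : 0 ≤ (1 + (r : ℝ))⁻¹ * r * (P * idTensor A M v.proj).trace.re := by positivity
    linarith
  rw [ENNReal.inv_le_iff_inv_le]
  have h1r : (1 + (r : ℝ≥0∞)) = ENNReal.ofReal (1 + (r : ℝ)) := by
    rw [ENNReal.ofReal_add zero_le_one r.coe_nonneg, ENNReal.ofReal_one, ENNReal.ofReal_coe_nnreal]
  rw [h1r, ← ENNReal.ofReal_inv_of_pos hr]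
  exact ENNReal.ofReal_le_ofReal hge

theorem one_le_robustness {A B : Type*} (O O' : Set (SuperOp A B)) (Φ : SuperOp A B) :
    1 ≤ robustness O O' Φ :=
  le_iInf fun _ => le_iInf₂ fun _ _ => le_iInf fun _ => le_self_add

/-- If the sharpened measure with respect to the affine hull is finite, it is witnessed by a single
perfect test, whose acceptance probability is the same for all free channels. -/
theorem exists_perfectTest_of_RminAff {O : Set (SuperOp A B)} {Φ : SuperOp A B}
    (hΦ : IsChannel Φ) {k : ℝ} (hk : 0 < k) (h : RminAff O Φ = ENNReal.ofReal k) :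
    ∃ p ∈ perfectTests Φ,
      ∀ M ∈ O, (p.2 * idTensor A M (outerProduct p.1)).trace.re = k⁻¹ := by
  have hinv : (⨅ v : PureVec A, ⨆ M ∈ affineSpan ℝ O,
      ENNReal.ofReal (supportProj (idTensor A Φ v.proj) * idTensor A M v.proj).trace.re) =
      ENNReal.ofReal k⁻¹ := by
    rw [ENNReal.ofReal_inv_of_pos hk, ← h, RminAff, inv_inv]
  -- The support projection need not depend continuously on `v`, so near-optimal tests are collected
  -- first and a limit is taken in the compact set of all perfect tests.
  have key : ∀ n : ℕ, ∃ p ∈ perfectTests Φ, ∀ M ∈ O,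
      k⁻¹ ≤ (p.2 * idTensor A M (outerProduct p.1)).trace.re ∧
      (p.2 * idTensor A M (outerProduct p.1)).trace.re ≤ k⁻¹ + 1 / ((n : ℝ) + 1) := by
    intro n
    set c : ℝ := k⁻¹ + 1 / ((n : ℝ) + 1) with hc
    have hδ : 0 < 1 / ((n : ℝ) + 1) := by positivity
    have hkinv : 0 < k⁻¹ := inv_pos.2 hk
    have hlt : ENNReal.ofReal k⁻¹ < ENNReal.ofReal c :=
      (ENNReal.ofReal_lt_ofReal_iff (by positivity)).2 (by linarith)
    obtain ⟨v, hv⟩ := iInf_lt_iff.1 (hinv.trans_lt hlt)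
    set g : SuperOp A B → ℝ := fun M =>
      (supportProj (idTensor A Φ v.proj) * idTensor A M v.proj).trace.re
    have hg : ∀ (a b : ℝ) (M N : SuperOp A B), g (a • M + b • N) = a * g M + b * g N :=
      re_trace_mul_idTensor_combo _ _
    have hgc : ∀ M ∈ affineSpan ℝ O, g M < c := fun M hM =>
      (ENNReal.ofReal_lt_ofReal_iff (by positivity)).1 (lt_of_le_of_lt
        (le_iSup₂ (f := fun (M : SuperOp A B) (_ : M ∈ affineSpan ℝ O) =>
          ENNReal.ofReal (g M)) M hM) hv)
    have hconst : ∀ M ∈ affineSpan ℝ O, ∀ N ∈ affineSpan ℝ O, g M = g N := by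
      intro M hM N hN
      by_contra hne
      have hne' : g N - g M ≠ 0 := sub_ne_zero.2 (Ne.symm hne)
      -- If `g` took two values, the line through `M` and `N` would contain a point where `g` equals
      -- `c`.
      have := hgc _ (AffineMap.lineMap_mem ((c - g M) / (g N - g M)) hM hN)
      rw [AffineMap.lineMap_apply_module, hg] at this
      have heq : (1 - (c - g M) / (g N - g M)) * g M + (c - g M) / (g N - g M) * g N = c := by
        field_simp
        ring
      linarith
    refine ⟨(v.1, supportProj (idTensor A Φ v.proj)), ⟨v.2, ⟨posSemidef_supportProj _,
      posSemidef_one_sub_supportProj _⟩, hΦ.one_le_supportProj v⟩, fun M hM => ?_⟩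
    have hM' := subset_affineSpan ℝ O hM
    refine ⟨?_, (hgc M hM').le⟩
    have hle : ENNReal.ofReal k⁻¹ ≤ ENNReal.ofReal (g M) := by
      rw [← hinv]
      refine (iInf_le _ v).trans (iSup₂_le fun N hN => ?_)
      exact (congrArg ENNReal.ofReal (hconst N hN M hM')).le
    -- Clipping at zero is harmless because `k⁻¹` is positive.
    exact (ENNReal.ofReal_le_ofReal_iff'.1 hle).resolve_right (not_le.2 hkinv)
  choose p hp hpM using key
  obtain ⟨q, hq, φ, hφ, hlim⟩ := (isCompact_perfectTests Φ).tendsto_subseq hp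
  refine ⟨q, hq, fun M hM => ?_⟩
  have h₁ := ((continuous_testValue M).tendsto q).comp hlim
  have h₂ : Tendsto (fun n => k⁻¹ + 1 / ((φ n : ℝ) + 1)) atTop (𝓝 (k⁻¹ + 0)) :=
    (tendsto_one_div_add_atTop_nhds_zero_nat.comp hφ.tendsto_atTop).const_add _
  rw [add_zero] at h₂
  exact le_antisymm (le_of_tendsto_of_tendsto' h₁ h₂ fun n => (hpM _ M hM).2)
    (ge_of_tendsto' h₁ fun n => (hpM _ M hM).1)

end Measures

/-! ### Free superchannels -/

section FreeSuperchannels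

variable {A B C D : Type*} [Fintype A] [DecidableEq A] [Fintype B]
  [Fintype C] [DecidableEq C] [Fintype D]

omit [DecidableEq A] [DecidableEq C] in
theorem IsSuperchannel.map_combo {Θ : SuperOp A B → SuperOp C D} (hΘ : IsSuperchannel Θ)
    (c r : ℝ) (L M : SuperOp A B) : Θ (c • (L + r • M)) = c • (Θ L + r • Θ M) := by
  obtain ⟨n, pre, post, -, -, h⟩ := hΘ
  simp only [h]
  refine LinearMap.ext fun X => ?_
  have hadd : idTensor (Fin n) (c • (L + r • M)) (pre X) =
      (c : ℂ) • (idTensor (Fin n) L (pre X) + (r : ℂ) • idTensor (Fin n) M (pre X)) := rfl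
  change post (idTensor (Fin n) (c • (L + r • M)) (pre X)) = _
  rw [hadd, map_smul, map_add, map_smul]
  rfl

omit [DecidableEq A] [DecidableEq C] in
theorem robustness_map_le {Θ : SuperOp A B → SuperOp C D} (hΘ : IsSuperchannel Θ)
    {O₁ O₁' : Set (SuperOp A B)} {O₂ O₂' : Set (SuperOp C D)} (h : Set.MapsTo Θ O₁ O₂)
    (h' : Set.MapsTo Θ O₁' O₂') (L : SuperOp A B) :
    robustness O₂ O₂' (Θ L) ≤ robustness O₁ O₁' L := by
  refine le_iInf fun r => le_iInf₂ fun M hM => le_iInf fun hr => ?_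
  refine iInf_le_of_le r (iInf₂_le_of_le (Θ M) (h' hM) (iInf_le_of_le ?_ le_rfl))
  rw [← hΘ.map_combo]
  exact h hr

variable [DecidableEq B]

/-- The measure-and-prepare superchannel: convexity keeps its outputs allowed, and perfect tests
give `T` acceptance probability `1`. What remains for freeness is isolated in `hfree`. -/
theorem exists_freeSuperchannel (𝓡' : ResourceTheory A B) (𝓡 : ResourceTheory C D)
    (hconvex : Convex ℝ 𝓡.all) {T : SuperOp A B} (hT : T ∈ 𝓡'.all) {ι : Type} [Fintype ι]
    {w : ι → ℝ} {p : ι → EuclideanSpace ℂ (A × A) × Matrix (A × B) (A × B) ℂ}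
    (hw : ∀ i, 0 ≤ w i) (hw' : ∑ i, w i = 1) (hp : ∀ i, p i ∈ perfectTests T)
    {Φ N : SuperOp C D} (hΦ : Φ ∈ 𝓡.all) (hN : N ∈ 𝓡.all)
    (hfree : ∀ M ∈ 𝓡'.free,
      ∀ t : ℝ, t = ∑ i, w i * ((p i).2 * idTensor A M (outerProduct (p i).1)).trace.re → 0 ≤ t →
        t • Φ + (1 - t) • N ∈ 𝓡.free) :
    ∃ Θ ∈ freeSuperchannels 𝓡' 𝓡, Θ T = Φ := by
  let v : ι → PureVec A := fun i => ⟨(p i).1, (hp i).1⟩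
  obtain ⟨Θ, hΘ, hΘL⟩ := exists_isSuperchannel_of_tests hw hw'
    (fun i => (v i).posSemidef_proj) (fun i => (v i).trace_proj) (fun i => (hp i).2.1.1)
    (fun i => (hp i).2.1.2) (𝓡.isChannel_of_mem_all Φ hΦ) (𝓡.isChannel_of_mem_all N hN)
  let t : SuperOp A B → ℝ := fun L => ∑ i, w i * ((p i).2 * idTensor A L (v i).proj).trace.re
  have hIcc : ∀ L, IsChannel L → ∀ i, _ := fun L hL i =>
    (hp i).2.1.1.trace_mul_mem_Icc (hp i).2.1.2 (hL.posSemidef_idTensor_proj (v i))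
      (hL.trace_idTensor_proj (v i))
  have hval : ∀ L, IsChannel L → Θ L = t L • Φ + (1 - t L) • N := by
    intro L hL
    have h₁ : (∑ i, (w i : ℂ) * ((p i).2 * idTensor A L (v i).proj).trace) = (t L : ℂ) := by
      simp only [t, Complex.ofReal_sum, Complex.ofReal_mul]
      exact Finset.sum_congr rfl fun i _ => by rw [(hIcc L hL i).1, Complex.ofReal_re]
    have h₂ : (∑ i, (w i : ℂ) * ((1 - (p i).2) * idTensor A L (v i).proj).trace) =
        ((1 - t L : ℝ) : ℂ) := by
      simp only [sub_mul, one_mul, Matrix.trace_sub, hL.trace_idTensor_proj, mul_sub, mul_one,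
        Finset.sum_sub_distrib, h₁, ← Complex.ofReal_sum, hw', Complex.ofReal_sub]
    rw [hΘL, h₁, h₂]
    rfl
  have ht0 : ∀ L, IsChannel L → 0 ≤ t L := fun L hL =>
    Finset.sum_nonneg fun i _ => mul_nonneg (hw i) (hIcc L hL i).2.1
  have ht1 : ∀ L, IsChannel L → t L ≤ 1 := fun L hL => by
    rw [← hw']
    exact Finset.sum_le_sum fun i _ => mul_le_of_le_one_right (hw i) (hIcc L hL i).2.2
  have hTch := 𝓡'.isChannel_of_mem_all T hT
  have htT : t T = 1 := by
    rw [← hw']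
    refine Finset.sum_congr rfl fun i _ => ?_
    rw [le_antisymm (hIcc T hTch i).2.2 (hp i).2.2, mul_one]
  refine ⟨Θ, ⟨hΘ, fun L hL => ?_, fun M hM => ?_⟩, ?_⟩
  · have hLch := 𝓡'.isChannel_of_mem_all L hL
    rw [hval L hLch]
    exact hconvex hΦ hN (ht0 L hLch) (sub_nonneg.2 (ht1 L hLch)) (by ring)
  · have hMch := 𝓡'.isChannel_of_mem_all M (𝓡'.free_subset_all hM)
    rw [hval M hMch]
    exact hfree M hM (t M) rfl (ht0 M hMch)
  · rw [hval T hTch, htT]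
    simp

end FreeSuperchannels

/-! ### Attainment of the smoothed robustness -/

section Smoothing

variable {C D : Type*}

/-- A decomposition of the free channel `X` with `1 + r < c` is rewritten with weight exactly `c⁻¹`
on `Φ`, by diluting the noise `M` with `X` itself; the mixture is still `X`. -/
theorem exists_mix_of_robustness_lt {O O' : Set (SuperOp C D)} (hO : O ⊆ O')
    (hO' : Convex ℝ O') {Φ : SuperOp C D} {c : ℝ} (h : robustness O O' Φ < ENNReal.ofReal c) :
    ∃ N ∈ O', c⁻¹ • Φ + (1 - c⁻¹) • N ∈ O := by
  simp only [robustness, iInf_lt_iff] at h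
  obtain ⟨r, M, hM, hX, hlt⟩ := h
  set X := (1 + (r : ℝ))⁻¹ • (Φ + (r : ℝ) • M) with hXdef
  have hr := r.coe_nonneg
  have h1r : (1 + (r : ℝ≥0∞)) = ENNReal.ofReal (1 + (r : ℝ)) := by
    rw [ENNReal.ofReal_add zero_le_one hr, ENNReal.ofReal_one, ENNReal.ofReal_coe_nnreal]
  rw [h1r, ENNReal.ofReal_lt_ofReal_iff'] at hlt
  have hc : 0 < c - 1 := by linarith [hlt.1]
  have hc0 : 0 < c := hlt.2
  refine ⟨((c - 1 - r) / (c - 1)) • X + (r / (c - 1)) • M, hO' (hO hX) hM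
    (div_nonneg (by linarith [hlt.1]) hc.le) (div_nonneg hr hc.le) (by field_simp; ring), ?_⟩
  have hΦ : Φ = (1 + (r : ℝ)) • X - (r : ℝ) • M := by
    rw [hXdef, smul_inv_smul₀ (by positivity), add_sub_cancel_right]
  convert hX using 1
  rw [hΦ]
  match_scalars <;> field_simp <;> ring

variable [Fintype C] [DecidableEq C] [Fintype D]

omit [Fintype D] in
theorem mem_of_choi_mem_image {S : Set (SuperOp C D)} {Φ : SuperOp C D} (h : choi Φ ∈ choi '' S) :
    Φ ∈ S := by
  obtain ⟨Ψ, hΨ, hΨΦ⟩ := h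
  rwa [← choi_injective hΨΦ]

variable [DecidableEq D]

/-- The infima are attained: with weights `c n → k`, both channels have convergent subsequences, and
the closeness and freeness conditions survive the limit. -/
theorem exists_mix_of_smooth_le [Nonempty C] (𝓡 : ResourceTheory C D) (hclosed : IsClosedOps 𝓡.all)
    {O' : Set (SuperOp C D)} (hO : 𝓡.free ⊆ O') (hO' : Convex ℝ O') (hO'cl : IsClosedOps O')
    (hO'all : O' ⊆ 𝓡.all) {ε : ℝ} {Φ : SuperOp C D} {k : ℝ} (hk : 0 < k)
    (h : smooth 𝓡 (robustness 𝓡.free O') ε Φ ≤ ENNReal.ofReal k) :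
    ∃ Ψ ∈ 𝓡.all, 1 - ε ≤ channelFidelity Ψ Φ ∧
      ∃ N ∈ O', k⁻¹ • Ψ + (1 - k⁻¹) • N ∈ 𝓡.free := by
  let c : ℕ → ℝ := fun n => k + 1 / ((n : ℝ) + 1)
  have hc : Tendsto c atTop (𝓝 k) := by
    simpa only [add_zero] using tendsto_one_div_add_atTop_nhds_zero_nat.const_add k
  have key : ∀ n, ∃ Ψ ∈ 𝓡.all, 1 - ε ≤ channelFidelity Ψ Φ ∧
      ∃ N ∈ O', (c n)⁻¹ • Ψ + (1 - (c n)⁻¹) • N ∈ 𝓡.free := by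
    intro n
    have hδ : 0 < 1 / ((n : ℝ) + 1) := by positivity
    have hlt : smooth 𝓡 (robustness 𝓡.free O') ε Φ < ENNReal.ofReal (c n) :=
      h.trans_lt ((ENNReal.ofReal_lt_ofReal_iff (by positivity)).2 (by simp only [c]; linarith))
    simp only [smooth, iInf_lt_iff] at hlt
    obtain ⟨Ψ, hΨ, hF, hlt⟩ := hlt
    exact ⟨Ψ, hΨ, hF, exists_mix_of_robustness_lt hO hO' hlt⟩
  choose Ψ hΨ hF N hN hmix using key
  have hcomp := (isCompact_image_choi hclosed 𝓡.isChannel_of_mem_all).prod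
    (isCompact_image_choi hO'cl fun M hM => 𝓡.isChannel_of_mem_all M (hO'all hM))
  obtain ⟨⟨_, _⟩, ⟨⟨Ψ', hΨ', rfl⟩, ⟨N', hN', rfl⟩⟩, φ, hφ, hlim⟩ := hcomp.tendsto_subseq
    (x := fun n => (choi (Ψ n), choi (N n))) fun n => ⟨⟨_, hΨ n, rfl⟩, ⟨_, hN n, rfl⟩⟩
  have hlimΨ : Tendsto (fun n => choi (Ψ (φ n))) atTop (𝓝 (choi Ψ')) :=
    (continuous_fst.tendsto _).comp hlim
  have hlimN : Tendsto (fun n => choi (N (φ n))) atTop (𝓝 (choi N')) :=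
    (continuous_snd.tendsto _).comp hlim
  refine ⟨Ψ', hΨ', le_channelFidelity_iff.2 fun ρ => ?_, N', hN', mem_of_choi_mem_image ?_⟩
  · have hherm : ∀ Ψ ∈ 𝓡.all, (idTensor C Ψ ρ.1).IsHermitian := fun Ψ hΨ =>
      ((𝓡.isChannel_of_mem_all Ψ hΨ).1.posSemidef_idTensor ρ.2.1).1
    have h₁ := (continuousOn_fidelity_left (idTensor C Φ ρ.1) _ (hherm Ψ' hΨ')).tendsto.comp
      (tendsto_nhdsWithin_iff.2 ⟨tendsto_idTensor hlimΨ ρ.1,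
        Eventually.of_forall fun n => hherm _ (hΨ (φ n))⟩)
    exact ge_of_tendsto' h₁ fun n => le_channelFidelity_iff.1 (hF (φ n)) ρ
  · have hcφ : Tendsto (fun n => (c (φ n))⁻¹) atTop (𝓝 k⁻¹) :=
      (hc.comp hφ.tendsto_atTop).inv₀ hk.ne'
    have h₁ := (hcφ.smul hlimΨ).add ((hcφ.const_sub 1).smul hlimN)
    exact 𝓡.isClosed_free.mem_of_tendsto h₁ (Eventually.of_forall fun n => ⟨_, hmix (φ n), rfl⟩)

end Smoothing

/-! ### Cost as a rounded measure: monotonicity plus achievability -/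

section Cost

variable {ι : Type*} {A B : ι → Type*}
    [∀ i, Fintype (A i)] [∀ i, DecidableEq (A i)]
    [∀ i, Fintype (B i)] [∀ i, DecidableEq (B i)]
    {C D : Type*} [Fintype C] [DecidableEq C] [Fintype D] [DecidableEq D]
    {𝓡' : ∀ i, ResourceTheory (A i) (B i)} {𝓡 : ResourceTheory C D}
    {𝓣 : Set (Σ i, SuperOp (A i) (B i))} {ε : ℝ} {Φ : SuperOp C D}

/-- The frame shared by both parts: `hmono` yields the lower bound on the cost, `hach` the upper
bound. Achievability is required only for finite values, as an infinite one bounds everything. -/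
theorem resourceCost_eq_ceilRef (f : SuperOp C D → ℝ≥0∞)
    (hmono : ∀ T ∈ 𝓣, ∀ Θ ∈ freeSuperchannels (𝓡' T.1) 𝓡, f (Θ T.2) ≤ Rmin (𝓡' T.1).free T.2)
    (h𝓣 : ∀ T ∈ 𝓣, T.2 ∈ (𝓡' T.1).all)
    (hach : ∀ T ∈ 𝓣, ∀ k : ℝ, 1 ≤ k → Rmin (𝓡' T.1).free T.2 = ENNReal.ofReal k →
      smooth 𝓡 f ε Φ ≤ ENNReal.ofReal k →
      ∃ Θ ∈ freeSuperchannels (𝓡' T.1) 𝓡, 1 - ε ≤ channelFidelity (Θ T.2) Φ)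
    (hone : ∀ T ∈ 𝓣, 1 ≤ Rmin (𝓡' T.1).free T.2) :
    resourceCost 𝓡' 𝓡 𝓣 ε Φ = ceilRef 𝓡' 𝓣 (smooth 𝓡 f ε Φ) := by
  refine le_antisymm (le_iInf₂ fun T hT => le_iInf fun hle => ?_)
    (le_iInf₂ fun T hT => le_iInf₂ fun Θ hΘ => le_iInf fun hF =>
      iInf₂_le_of_le T hT (iInf_le_of_le ?_ le_rfl))
  · by_cases htop : Rmin (𝓡' T.1).free T.2 = ⊤
    · rw [htop]
      exact le_top
    · have hk := (ENNReal.ofReal_toReal htop).symm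
      have h1 := hone T hT
      rw [hk, ENNReal.one_le_ofReal] at h1
      obtain ⟨Θ, hΘ, hF⟩ := hach T hT _ h1 hk (hle.trans hk.le)
      exact iInf₂_le_of_le T hT (iInf₂_le_of_le Θ hΘ
        (iInf_le_of_le (by rwa [channelFidelity_comm]) le_rfl))
  · refine le_trans ?_ (hmono T hT Θ hΘ)
    exact iInf₂_le_of_le (Θ T.2) (hΘ.2.1 _ (h𝓣 T hT))
      (iInf_le_of_le (by rwa [channelFidelity_comm]) le_rfl)

end Cost

theorem ResourceTheory.free_nonempty_of_Rmin_ne_top {A B : Type*} [Fintype A] [DecidableEq A]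
    [Fintype B] [DecidableEq B] {𝓡 : ResourceTheory A B} {Φ : SuperOp A B}
    (h : Rmin 𝓡.free Φ ≠ ⊤) : 𝓡.free.Nonempty := by
  by_contra hne
  exact h (by simp [Rmin, RH, Set.not_nonempty_iff_eq_empty.1 hne])

end

theorem corollary2 {ι : Type*} {A B : ι → Type*}
    [∀ i, Fintype (A i)] [∀ i, DecidableEq (A i)] [∀ i, Nonempty (A i)]
    [∀ i, Fintype (B i)] [∀ i, DecidableEq (B i)] [∀ i, Nonempty (B i)]
    {C D : Type*} [Fintype C] [DecidableEq C] [Nonempty C]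
    [Fintype D] [DecidableEq D] [Nonempty D]
    (𝓡' : ∀ i, ResourceTheory (A i) (B i)) (𝓡 : ResourceTheory C D)
    (hconvex : Convex ℝ 𝓡.all) (hclosed : IsClosedOps 𝓡.all)
    (𝓣 : Set (Σ i, SuperOp (A i) (B i))) (h𝓣 : ∀ T ∈ 𝓣, T.2 ∈ (𝓡' T.1).all)
    (ε : ℝ) (hε0 : 0 ≤ ε) (hε1 : ε ≤ 1)
    (Φ : SuperOp C D) (hΦ : Φ ∈ 𝓡.all) :
    ((∀ T ∈ 𝓣, Rmin (𝓡' T.1).free T.2 = Rs (𝓡' T.1) T.2) →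
      resourceCost 𝓡' 𝓡 𝓣 ε Φ = ceilRef 𝓡' 𝓣 (smooth 𝓡 (Rs 𝓡) ε Φ)) ∧
    ((∀ T ∈ 𝓣, RminAff (𝓡' T.1).free T.2 = Rmax (𝓡' T.1) T.2) →
      resourceCost 𝓡' 𝓡 𝓣 ε Φ = ceilRef 𝓡' 𝓣 (smooth 𝓡 (Rmax 𝓡) ε Φ)) := by
  have hch : ∀ T ∈ 𝓣, IsChannel T.2 := fun T hT => (𝓡' T.1).isChannel_of_mem_all _ (h𝓣 T hT)
  constructor
  · intro h
    refine resourceCost_eq_ceilRef (Rs 𝓡) (fun T hT Θ hΘ => ?_) h𝓣 (fun T hT k hk hTk hle => ?_)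
      fun T hT => (h T hT).symm ▸ one_le_robustness _ _ _
    · rw [h T hT]
      exact robustness_map_le hΘ.1 hΘ.2.2 hΘ.2.2 _
    · have hk0 : 0 < k := one_pos.trans_le hk
      obtain ⟨κ, _, w, p, hw, hw', hp, hM⟩ := exists_tests_of_le_Rmin (𝓡' T.1) (hch T hT) hk0
        hTk.ge (ResourceTheory.free_nonempty_of_Rmin_ne_top (hTk ▸ ENNReal.ofReal_ne_top))
      obtain ⟨Ψ, hΨ, hF, N, hN, hmix⟩ := exists_mix_of_smooth_le 𝓡 hclosed subset_rfl
        𝓡.convex_free 𝓡.isClosed_free 𝓡.free_subset_all hk0 hle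
      obtain ⟨Θ, hΘ, hΘT⟩ := exists_freeSuperchannel (𝓡' T.1) 𝓡 hconvex (h𝓣 T hT) hw hw' hp hΨ
        (𝓡.free_subset_all hN) fun M hMf t ht ht0 => by
          have htk : t * k ≤ 1 := by
            have := mul_le_mul_of_nonneg_right (ht.trans_le (hM M hMf)) hk0.le
            rwa [inv_mul_cancel₀ hk0.ne'] at this
          -- `t Ψ + (1 - t) N = tk (k⁻¹ Ψ + (1 - k⁻¹) N) + (1 - tk) N`, a convex combination of free
          -- channels.
          convert 𝓡.convex_free hmix hN (mul_nonneg ht0 hk0.le) (sub_nonneg.2 htk)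
            (by ring) using 1
          match_scalars <;> field_simp
          ring
      exact ⟨Θ, hΘ, hΘT ▸ hF⟩
  · intro h
    have hmin : ∀ T ∈ 𝓣, Rmin (𝓡' T.1).free T.2 = Rmax (𝓡' T.1) T.2 := fun T hT =>
      le_antisymm (Rmin_le_robustness (𝓡' T.1).isChannel_of_mem_all _)
        ((h T hT).symm.trans_le (RminAff_le_Rmin (hch T hT) _))
    refine resourceCost_eq_ceilRef (Rmax 𝓡) (fun T hT Θ hΘ => ?_) h𝓣 (fun T hT k hk hTk hle => ?_)
      fun T hT => (hmin T hT).symm ▸ one_le_robustness _ _ _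
    · rw [hmin T hT]
      exact robustness_map_le hΘ.1 hΘ.2.2 hΘ.2.1 _
    · have hk0 : 0 < k := one_pos.trans_le hk
      obtain ⟨p, hp, hM⟩ := exists_perfectTest_of_RminAff (hch T hT) hk0
        (((h T hT).trans (hmin T hT).symm).trans hTk)
      obtain ⟨Ψ, hΨ, hF, N, hN, hmix⟩ := exists_mix_of_smooth_le 𝓡 hclosed 𝓡.free_subset_all
        hconvex hclosed subset_rfl hk0 hle
      -- A single test suffices: every free `M` has `t = k⁻¹` and is sent to the free mixture `hmix`
      -- itself.
      obtain ⟨Θ, hΘ, hΘT⟩ := exists_freeSuperchannel (ι := Unit) (w := fun _ => 1)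
        (p := fun _ => p) (𝓡' T.1) 𝓡 hconvex (h𝓣 T hT) (fun _ => zero_le_one) (by simp)
        (fun _ => hp) hΨ hN fun M hMf t ht _ => by
          rw [Fintype.sum_unique, one_mul, hM M hMf] at ht
          rwa [ht]
      exact ⟨Θ, hΘ, hΘT ▸ hF⟩
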